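/- Let $M\subseteq\mathbb R^m$ be open and connected, and let $X_1,\dots,X_k$ be smooth vector fields on $M$ for which there are constants $K,L\in\mathbb R$ with $\|X_i(x)\|\le K$ and $\|X_i(x)-X_i(y)\|\le L\|x-y\|$ for all $x,y\in M$ and all $i$. For $x\in M$ and $u\in L^1([0,1];\mathbb R^k)$ consider absolutely continuous curves $\gamma:[0,1]\to M$ with $$\gamma(0)=x,\qquad \dot\gamma(t)=\sum_{i=1}^k u_i(t)\,X_i(\gamma(t))\quad\text{for almost every } t\in[0,1].$$ Such a curve is unique if it exists. The endpoint map $\mathrm{End}_x$ is defined on the set of all $u\in L^1([0,1];\mathbb R^k)$ for which such a curve $\gamma$ exists on all of $[0,1]$, and $\mathrm{End}_x(u)=\gamma(1)\in M$. For $A\subseteq M$ and $y\in A$ let $C_y(A)$ be the set of points $c(1)$, where $c:[0,1]\to M$ runs over the smooth curves with $c(0)=y$ and $c([0,1])\subseteq A$. A subset $N\subseteq M$ is an initial submanifold of $M$ if for every $y\in N$ there are a smooth chart $(U,\varphi)$ of $M$ with $y\in U$, $\varphi(y)=0$, and an integer $0\le n\le m$ such that $\varphi(C_y(U\cap N))=\varphi(U)\cap(\mathbb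 R^n\times\{0\})$. A map $i:N\to M$ between smooth manifolds is an initial mapping if for every smooth manifold $Z$ a map $f:Z\to N$ is smooth if and only if $i\circ f:Z\to M$ is smooth. Manifolds are finite-dimensional, without boundary, Hausdorff and paracompact. **Theorem.** For every $x\in M$, the image $N=\mathrm{End}_x\big(\mathrm{dom}(\mathrm{End}_x)\big)$ is an initial submanifold of $M$. Moreover $N$ carries a (necessarily unique) smooth manifold structure, whose topology may be finer than the subspace topology, for which the inclusion $N\hookrightarrow M$ is an injective immersion and an initial mapping. -/

import Mathlib

open scoped Manifold ContDiff
open MeasureTheory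

universe u

/-! ### Initial submanifolds and initial mappings -/

/-- `smoothPathComponent A x₀` is the set `C_{x₀}(A)` of all points of `A` which can be connected
to `x₀` by a smooth curve `[0,1] → M` lying in `A`. -/
def smoothPathComponent {m : ℕ} {M : Type*} [TopologicalSpace M]
    [ChartedSpace (EuclideanSpace ℝ (Fin m)) M] (A : Set M) (x₀ : M) : Set M :=
  {x | ∃ c : ℝ → M, ContMDiffOn 𝓘(ℝ, ℝ) (𝓡 m) ∞ c (Set.Icc 0 1) ∧
    c 0 = x₀ ∧ c 1 = x ∧ ∀ t ∈ Set.Icc (0 : ℝ) 1, c t ∈ A}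

/-- The subspace `ℝⁿ × {0}` of `ℝᵐ` (for `n ≤ m`). -/
def coordinateSubspace (m n : ℕ) : Set (EuclideanSpace ℝ (Fin m)) :=
  {y | ∀ j : Fin m, n ≤ (j : ℕ) → y j = 0}

/-- `(e.source, e)` is an initial submanifold chart for `N` centered at `x`: a chart of the smooth
manifold `M` with `e x = 0` and `e (C_x(U ∩ N)) = e(U) ∩ (ℝⁿ × {0})` for some `n`, where
`U = e.source`. -/
def IsInitialSubmanifoldChart {m : ℕ} {M : Type*} [TopologicalSpace M]
    [ChartedSpace (EuclideanSpace ℝ (Fin m)) M] (N : Set M) (x : M)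
    (e : OpenPartialHomeomorph M (EuclideanSpace ℝ (Fin m))) : Prop :=
  e ∈ IsManifold.maximalAtlas (𝓡 m) ∞ M ∧ x ∈ e.source ∧ e x = 0 ∧
    ∃ n : ℕ, n ≤ m ∧
      e '' smoothPathComponent (m := m) (e.source ∩ N) x = e.target ∩ coordinateSubspace m n

/-- `N` is an initial submanifold of `M`: around each of its points there is an initial
submanifold chart centered at that point. -/
def IsInitialSubmanifold {m : ℕ} {M : Type*} [TopologicalSpace M]
    [ChartedSpace (EuclideanSpace ℝ (Fin m)) M] (N : Set M) : Prop :=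
  ∀ x ∈ N, ∃ e : OpenPartialHomeomorph M (EuclideanSpace ℝ (Fin m)),
    IsInitialSubmanifoldChart N x e

/-- A mapping `i : N → M` is initial if for every (paracompact Hausdorff smooth) manifold `Z`, a
mapping `f : Z → N` is smooth if and only if `i ∘ f : Z → M` is smooth. -/
def IsInitialMapping {m r : ℕ} {M N : Type*}
    [TopologicalSpace M] [ChartedSpace (EuclideanSpace ℝ (Fin m)) M]
    [TopologicalSpace N] [ChartedSpace (EuclideanSpace ℝ (Fin r)) N] (i : N → M) : Prop :=
  ∀ (d : ℕ) (Z : Type u) [TopologicalSpace Z] [ChartedSpace (EuclideanSpace ℝ (Fin d)) Z]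
    [IsManifold (𝓡 d) ∞ Z] [T2Space Z] [ParacompactSpace Z] (f : Z → N),
    ContMDiff (𝓡 d) (𝓡 r) ∞ f ↔ ContMDiff (𝓡 d) (𝓡 m) ∞ (i ∘ f)

/-- An injective immersion: an injective smooth map whose differential is injective at every
point. -/
def IsInjectiveImmersion {m r : ℕ} {M N : Type*}
    [TopologicalSpace M] [ChartedSpace (EuclideanSpace ℝ (Fin m)) M]
    [TopologicalSpace N] [ChartedSpace (EuclideanSpace ℝ (Fin r)) N] (i : N → M) : Prop :=
  Function.Injective i ∧ ContMDiff (𝓡 r) (𝓡 m) ∞ i ∧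
    ∀ p : N, Function.Injective (mfderiv (𝓡 r) (𝓡 m) i p)

/-- The points of a subset `S` of `M`, as a type without any topology (in particular without the
subspace topology, which in general is not the manifold topology of an initial submanifold). -/
def Carrier {M : Type*} (S : Set M) : Type _ := {p : M // p ∈ S}

/-- The inclusion of `S` into `M`. -/
def Carrier.incl {M : Type*} (S : Set M) : Carrier S → M := Subtype.val

/-- `S` carries the structure of a (paracompact Hausdorff) smooth manifold for which the inclusion
`S → M` is an injective immersion and an initial mapping. (Initiality makes such a structure
unique.) -/
def InclusionIsInitial {m : ℕ} {M : Type*} [TopologicalSpace M]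
    [ChartedSpace (EuclideanSpace ℝ (Fin m)) M] (S : Set M) : Prop :=
  ∃ (r : ℕ) (_ : TopologicalSpace (Carrier S))
    (_ : ChartedSpace (EuclideanSpace ℝ (Fin r)) (Carrier S)),
    IsManifold (𝓡 r) ∞ (Carrier S) ∧ T2Space (Carrier S) ∧ ParacompactSpace (Carrier S) ∧
    IsInjectiveImmersion (m := m) (r := r) (Carrier.incl S) ∧
    IsInitialMapping.{u} (m := m) (r := r) (Carrier.incl S)

/-! ### Controlled curves and the endpoint map -/

/-- The Banach space `L¹([0,1]; ℝᵏ)` of controls. -/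
abbrev ControlSpace (k : ℕ) : Type :=
  Lp (EuclideanSpace ℝ (Fin k)) 1 (volume.restrict (Set.Icc (0 : ℝ) 1))

/-- `γ : [0,1] → M` is controlled by the vector fields `X₁, …, X_k` on the open set `M ⊆ ℝᵐ` with
control `u` and starts at `x`: it is absolutely continuous, lies in `M`, and satisfies
`γ'(t) = ∑ᵢ uᵢ(t) Xᵢ(γ(t))` for almost every `t ∈ [0,1]` and `γ(0) = x`. -/
structure IsControlledCurve {m k : ℕ} (M : TopologicalSpace.Opens (EuclideanSpace ℝ (Fin m)))
    (X : Fin k → EuclideanSpace ℝ (Fin m) → EuclideanSpace ℝ (Fin m))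
    (u : ControlSpace k) (x : M) (γ : ℝ → EuclideanSpace ℝ (Fin m)) : Prop where
  absolutelyContinuous : AbsolutelyContinuousOnInterval γ 0 1
  mem : ∀ t ∈ Set.Icc (0 : ℝ) 1, γ t ∈ M
  initial : γ 0 = x
  ode : ∀ᵐ t ∂(volume.restrict (Set.Icc (0 : ℝ) 1)),
    HasDerivAt γ (∑ i, u t i • X i (γ t)) t

/-- The set of all pairs `(u, x)` of a control and an initial value for which the controlled
differential equation has a solution on all of `[0,1]`. -/
def controlDomain {m k : ℕ} (M : TopologicalSpace.Opens (EuclideanSpace ℝ (Fin m)))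
    (X : Fin k → EuclideanSpace ℝ (Fin m) → EuclideanSpace ℝ (Fin m)) :
    Set (ControlSpace k × M) :=
  {p | ∃ γ : ℝ → EuclideanSpace ℝ (Fin m), IsControlledCurve M X p.1 p.2 γ}

/-- The endpoint map `End_x : u ↦ γ(1)`, where `γ` is the curve with initial value `x` controlled
by `u`, defined on all controls for which this curve exists on `[0,1]`. (For locally Lipschitz
vector fields the curve is unique on `[0,1]`.) -/
noncomputable def endpointMap {m k : ℕ} (M : TopologicalSpace.Opens (EuclideanSpace ℝ (Fin m)))
    (X : Fin k → EuclideanSpace ℝ (Fin m) → EuclideanSpace ℝ (Fin m)) (x : M)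
    (u : {u : ControlSpace k // (u, x) ∈ controlDomain M X}) : M :=
  ⟨u.2.choose 1, u.2.choose_spec.mem 1 (Set.right_mem_Icc.2 zero_le_one)⟩

/-! ### Volterra estimates -/

section Volterra

open Set

/-! Write the control equation as γ(t) = x + ∫₀ᵗ f(γ(s)) u(s) ds with f(p)c = ∑ cᵢ Xᵢ(p). Its
partial derivative in γ, on C([0,1], ℝᵐ), is the identity minus a Volterra operator, hence
invertible. The implicit function theorem therefore makes the endpoint a smooth function of (u, x)
on an open set (`IsIntegralSolution.exists_contDiffAt`). Controls can be concatenated and reversed,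
so N is the orbit of x under an equivalence relation. `EndpointSystem` abstracts these facts.

Let n be the largest rank of ∂End_y/∂u over all points y of the orbit and all controls. Through
every y there is a loop of rank n (`exists_loop_controlRank_eq`). Varying its control in n
directions and its initial point in transversal directions gives a local diffeomorphism of ℝᵐ that
sends ℝⁿ × {0} into N. By maximality of n, every infinitesimal motion inside the orbit is tangent to
the slices (`range_controlDeriv_le`). The normal coordinate of End_x(v) thus has derivative zero in
v, and since L¹ is separable it takes only countably many values (`exists_isSliceParametrization`).

Countable sets are totally disconnected, so a connected set mapped continuously into N within one
chart stays in one slice. This gives the initial submanifold charts. With the slices as open sets,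
it also shows that a map from a locally connected space that is continuous into M is continuous into
N; smoothness is then read off in slice coordinates, which is initiality. Paracompactness holds
because N is a continuous image of a second countable set of controls. -/

theorem integral_mul_primitive_pow {a : ℝ → ℝ} {t : ℝ} (ha : IntervalIntegrable a volume 0 t)
    (n : ℕ) :
    ∫ s in (0 : ℝ)..t, a s * (∫ r in (0 : ℝ)..s, a r) ^ n =
      (∫ r in (0 : ℝ)..t, a r) ^ (n + 1) / (n + 1) := by
  -- As `a` is merely integrable, its primitive is differentiable only almost everywhere; absolute
  -- continuity of the powers is what allows the power rule to be integrated.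
  have hG := ha.absolutelyContinuousOnInterval_intervalIntegral (c := 0) (by simp)
  have hpow : ∀ n : ℕ, AbsolutelyContinuousOnInterval
      (fun s ↦ (∫ r in (0 : ℝ)..s, a r) ^ (n + 1)) 0 t := by
    intro n
    induction n with
    | zero => simpa using hG
    | succ n ih => simpa [pow_succ] using ih.fun_mul hG
  have hI := (hpow n).integral_deriv_eq_sub
  rw [intervalIntegral.integral_same, zero_pow n.succ_ne_zero, sub_zero] at hI
  rw [← hI, eq_div_iff (by positivity), ← intervalIntegral.integral_mul_const]
  apply intervalIntegral.integral_congr_ae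
  filter_upwards [ha.ae_hasDerivAt_integral] with s hs hst
  rw [((hs (uIoc_subset_uIcc hst) 0 (by simp)).fun_pow (n + 1)).deriv]
  push_cast
  ring

/-- The factorial comes from iterated integration over ordered times, and it beats any geometric
growth, so no smallness of `a` is needed. -/
theorem volterra_iterate_le {a : ℝ → ℝ} (ha : IntervalIntegrable a volume 0 1)
    (hpos : ∀ t, 0 ≤ a t) {δ : ℕ → ℝ → ℝ} (hδ : ∀ n, ContinuousOn (δ n) (Icc 0 1)) {c : ℝ}
    (h₀ : ∀ t ∈ Icc (0 : ℝ) 1, δ 0 t ≤ c)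
    (hs : ∀ n, ∀ t ∈ Icc (0 : ℝ) 1, δ (n + 1) t ≤ ∫ s in (0 : ℝ)..t, a s * δ n s) (n : ℕ) :
    ∀ t ∈ Icc (0 : ℝ) 1, δ n t ≤ c * (∫ s in (0 : ℝ)..t, a s) ^ n / n.factorial := by
  induction n with
  | zero => simpa using h₀
  | succ n ih =>
    intro t ht
    have hsub : uIcc 0 t ⊆ uIcc (0 : ℝ) 1 := by
      rw [uIcc_of_le ht.1, uIcc_of_le zero_le_one]
      exact Icc_subset_Icc_right ht.2
    have hat : IntervalIntegrable a volume 0 t := ha.mono_set hsub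
    rw [uIcc_of_le zero_le_one] at hsub
    have hG := (hat.absolutelyContinuousOnInterval_intervalIntegral (c := 0) (by simp)).continuousOn
    calc δ (n + 1) t ≤ ∫ s in (0 : ℝ)..t, a s * δ n s := hs n t ht
      _ ≤ ∫ s in (0 : ℝ)..t, a s * (c * (∫ r in (0 : ℝ)..s, a r) ^ n / n.factorial) := by
        apply intervalIntegral.integral_mono_on ht.1
        · exact hat.mul_continuousOn ((hδ n).mono hsub)
        · exact hat.mul_continuousOn (by fun_prop)
        · intro s hs
          exact mul_le_mul_of_nonneg_left (ih s ⟨hs.1, hs.2.trans ht.2⟩) (hpos s)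
      _ = (∫ s in (0 : ℝ)..t, a s * (∫ r in (0 : ℝ)..s, a r) ^ n) * (c / n.factorial) := by
        rw [← intervalIntegral.integral_mul_const]
        congr 1 with s
        ring
      _ = c * (∫ s in (0 : ℝ)..t, a s) ^ (n + 1) / (n + 1).factorial := by
        rw [integral_mul_primitive_pow hat, Nat.factorial_succ]
        push_cast
        field_simp

theorem primitive_le_of_nonneg {a : ℝ → ℝ} (ha : IntervalIntegrable a volume 0 1)
    (hpos : ∀ t, 0 ≤ a t) {t : ℝ} (ht : t ∈ Icc (0 : ℝ) 1) :
    ∫ s in (0 : ℝ)..t, a s ≤ ∫ s in (0 : ℝ)..1, a s :=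
  intervalIntegral.integral_mono_interval le_rfl ht.1 ht.2 (Filter.Eventually.of_forall hpos) ha

/-- Grönwall's inequality with an integrable weight: iterate with the constant sequence `δ` and let
`n` tend to infinity. -/
theorem nonpos_of_le_volterra {a : ℝ → ℝ} (ha : IntervalIntegrable a volume 0 1)
    (hpos : ∀ t, 0 ≤ a t) {δ : ℝ → ℝ} (hδ : ContinuousOn δ (Icc 0 1))
    (hs : ∀ t ∈ Icc (0 : ℝ) 1, δ t ≤ ∫ s in (0 : ℝ)..t, a s * δ s) :
    ∀ t ∈ Icc (0 : ℝ) 1, δ t ≤ 0 := by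
  obtain ⟨c, hc⟩ := isCompact_Icc.exists_bound_of_continuousOn hδ
  intro t ht
  have key := fun n ↦ volterra_iterate_le ha hpos (δ := fun _ ↦ δ) (fun _ ↦ hδ)
    (c := c) (fun t ht ↦ (le_abs_self _).trans (hc t ht)) (fun _ ↦ hs) n t ht
  have hlim : Filter.Tendsto
      (fun n : ℕ ↦ c * (∫ s in (0 : ℝ)..t, a s) ^ n / n.factorial) Filter.atTop (nhds 0) := by
    simpa [mul_div_assoc] using
      (FloorSemiring.tendsto_pow_div_factorial_atTop (∫ s in (0 : ℝ)..t, a s)).const_mul c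
  exact ge_of_tendsto' hlim key

end Volterra

/-! ### Smoothness of superposition operators -/

section Superposition

variable {I : Type} [TopologicalSpace I] [CompactSpace I]
variable {E F : Type} [NormedAddCommGroup E] [NormedSpace ℝ E] [NormedAddCommGroup F]
  [NormedSpace ℝ F]

/-- The superposition operator `γ ↦ f ∘ γ` on continuous functions. -/
def superposition (I : Type) [TopologicalSpace I] [CompactSpace I] (f : C(E, F)) :
    C(I, E) → C(I, F) := fun γ ↦ f.comp γ

/-- Pointwise application of a continuous family of operators to a continuous function. -/
noncomputable def pointwiseApply (I : Type) [TopologicalSpace I] [CompactSpace I] (E F : Type)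
    [NormedAddCommGroup E] [NormedSpace ℝ E] [NormedAddCommGroup F] [NormedSpace ℝ F] :
    C(I, E →L[ℝ] F) →L[ℝ] C(I, E) →L[ℝ] C(I, F) :=
  LinearMap.mkContinuous₂
    (LinearMap.mk₂ ℝ
      (fun (A : C(I, E →L[ℝ] F)) (γ : C(I, E)) ↦ (⟨fun t ↦ A t (γ t), by fun_prop⟩ : C(I, F)))
      (fun _ _ _ ↦ by ext; simp) (fun _ _ _ ↦ by ext; simp)
      (fun _ _ _ ↦ by ext; simp) (fun _ _ _ ↦ by ext; simp)) 1
    (fun A γ ↦ by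
      rw [one_mul]
      refine (ContinuousMap.norm_le _ (by positivity)).2 fun t ↦ ?_
      exact (A t).le_of_opNorm_le_of_le (A.norm_coe_le_norm t) (γ.norm_coe_le_norm t))

@[simp]
theorem pointwiseApply_apply (A : C(I, E →L[ℝ] F)) (γ : C(I, E)) (t : I) :
    pointwiseApply I E F A γ t = A t (γ t) := rfl

/-- The mean value inequality is applied pointwise in `t`. Uniformity in `t` comes from the
continuity of `γ ↦ f' ∘ γ` in the sup norm. -/
theorem superposition_hasFDerivAt {f : C(E, F)} {f' : C(E, E →L[ℝ] F)}
    (hf : ∀ p, HasFDerivAt f (f' p) p) (γ : C(I, E)) :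
    HasFDerivAt (superposition I f) (pointwiseApply I E F (superposition I f' γ)) γ := by
  rw [hasFDerivAt_iff_isLittleO, Asymptotics.isLittleO_iff]
  intro ε hε
  have hcont : Continuous (superposition I f') := ContinuousMap.continuous_postcomp f'
  obtain ⟨η, hη, hball⟩ := Metric.continuous_iff.1 hcont γ ε hε
  filter_upwards [Metric.ball_mem_nhds γ hη] with γ' hγ'
  refine (ContinuousMap.norm_le _ (by positivity)).2 fun t ↦ ?_
  have hseg : ∀ z ∈ segment ℝ (γ t) (γ' t), ‖f' z - f' (γ t)‖ ≤ ε := by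
    rintro z hz
    rw [segment_eq_image'] at hz
    obtain ⟨s, hs, rfl⟩ := hz
    -- Every point of the segment is the value at `t` of a path on the straight line from `γ` to
    -- `γ'`, and that path lies in the same ball.
    have h1 : γ + s • (γ' - γ) ∈ Metric.ball γ η := by
      rw [mem_ball_iff_norm, add_sub_cancel_left, norm_smul]
      rw [mem_ball_iff_norm] at hγ'
      refine lt_of_le_of_lt ?_ hγ'
      rw [Real.norm_of_nonneg hs.1]
      exact mul_le_of_le_one_left (norm_nonneg _) hs.2
    have h2 := (hball _ h1).le
    rw [dist_eq_norm] at h2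
    exact (ContinuousMap.norm_coe_le_norm
      (superposition I f' (γ + s • (γ' - γ)) - superposition I f' γ) t).trans h2
  have hmv := (convex_segment (γ t) (γ' t)).norm_image_sub_le_of_norm_hasFDerivWithin_le'
    (fun z _ ↦ (hf z).hasFDerivWithinAt) hseg (left_mem_segment ℝ _ _) (right_mem_segment ℝ _ _)
  refine hmv.trans ?_
  gcongr
  exact (γ' - γ).norm_coe_le_norm t

/-- The derivative is again a superposition operator, that of `fderiv ℝ f`, followed by a bounded
bilinear map. The target `F` changes in each step, so the induction quantifies over it. -/
theorem contDiff_superposition_nat (n : ℕ) : ∀ {F : Type} [NormedAddCommGroup F] [NormedSpace ℝ F]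
    (f : C(E, F)), ContDiff ℝ n f → ContDiff ℝ n (superposition I f) := by
  induction n with
  | zero =>
    intro F _ _ f _
    exact contDiff_zero.2 (ContinuousMap.continuous_postcomp f)
  | succ n ih =>
    intro F _ _ f hf
    have hf1 : ContDiff ℝ 1 f := hf.of_le (by norm_cast; omega)
    have hf' : ContDiff ℝ n (fderiv ℝ f) := hf.fderiv_right (by norm_cast)
    let f' : C(E, E →L[ℝ] F) := ⟨fderiv ℝ f, hf'.continuous⟩
    rw [show ((n + 1 : ℕ) : WithTop ℕ∞) = (n : WithTop ℕ∞) + 1 by norm_cast,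
      contDiff_succ_iff_hasFDerivAt (n := (n : ℕ))]
    refine ⟨fun γ ↦ pointwiseApply I E F (superposition I f' γ), ?_, fun γ ↦ ?_⟩
    · exact (pointwiseApply I E F).contDiff.comp (ih f' hf')
    · exact superposition_hasFDerivAt
        (fun p ↦ ((hf1.differentiable (by simp)) p).hasFDerivAt) γ

theorem contDiff_superposition {f : C(E, F)} (hf : ContDiff ℝ ∞ f) :
    ContDiff ℝ ∞ (superposition I f) :=
  contDiff_infty.2 fun n ↦ contDiff_superposition_nat n f (contDiff_infty.1 hf n)

end Superposition

/-! ### The controlled integral equation -/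

section IntegralEquation

set_option linter.unusedSectionVars false

open Set Filter Topology

variable {V E : Type} [NormedAddCommGroup V] [NormedSpace ℝ V] [NormedAddCommGroup E]
  [NormedSpace ℝ E]

/-- Superposition operators need a globally defined map. Agreement on a neighbourhood of `K`, rather
than on `K` alone, lets nearby curves solve the original equation as well. -/
theorem exists_contDiff_eq_nhdsSet [FiniteDimensional ℝ E] {F : Type} [NormedAddCommGroup F]
    [NormedSpace ℝ F] {M K : Set E} (hM : IsOpen M) (hK : IsCompact K) (hKM : K ⊆ M) {f : E → F}
    (hf : ContDiffOn ℝ ∞ f M) :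
    ∃ g : E → F, ContDiff ℝ ∞ g ∧ ∀ᶠ p in 𝓝ˢ K, g p = f p := by
  obtain ⟨χ, h0, h1, -⟩ := exists_contMDiffMap_zero_one_nhds_of_isClosed 𝓘(ℝ, E) (n := ⊤)
    hM.isClosed_compl hK.isClosed (disjoint_compl_left_iff_subset.2 hKM)
  have hχ : ContDiff ℝ ∞ χ := χ.contMDiff.contDiff
  refine ⟨fun p ↦ χ p • f p, contDiff_iff_contDiffAt.2 fun p ↦ ?_, ?_⟩
  · by_cases hp : p ∈ M
    · exact hχ.contDiffAt.smul (hf.contDiffAt (hM.mem_nhds hp))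
    · have : (fun p ↦ χ p • f p) =ᶠ[𝓝 p] fun _ ↦ 0 := by
        filter_upwards [h0.filter_mono (nhds_le_nhdsSet hp)] with q hq
        rw [hq, zero_smul]
      exact contDiffAt_const.congr_of_eventuallyEq this
  · filter_upwards [h1] with p hp
    rw [hp, one_smul]

theorem uIoc_zero_subset {t : ℝ} (ht : t ∈ Icc (0 : ℝ) 1) : uIoc 0 t ⊆ Icc 0 1 := by
  rw [uIoc_of_le ht.1]
  exact fun s hs ↦ ⟨hs.1.le, hs.2.trans ht.2⟩

theorem ae_uIoc_of_ae_restrict {p : ℝ → Prop} (h : ∀ᵐ s ∂volume.restrict (Icc (0 : ℝ) 1), p s)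
    {t : ℝ} (ht : t ∈ Icc (0 : ℝ) 1) : ∀ᵐ s, s ∈ uIoc 0 t → p s := by
  rw [ae_restrict_iff' measurableSet_Icc] at h
  filter_upwards [h] with s hs hst using hs (uIoc_zero_subset ht hst)

theorem IntegrableOn.intervalIntegrable_zero {f : ℝ → E} (hf : IntegrableOn f (Icc 0 1))
    {t : ℝ} (ht : t ∈ Icc (0 : ℝ) 1) : IntervalIntegrable f volume 0 t :=
  intervalIntegrable_iff.2 (hf.mono_set (uIoc_zero_subset ht))

theorem IntegrableOn.clm_apply_of_continuousOn {A : ℝ → V →L[ℝ] E} (hA : ContinuousOn A (Icc 0 1))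
    {u : ℝ → V} (hu : IntegrableOn u (Icc 0 1)) :
    IntegrableOn (fun s ↦ A s (u s)) (Icc 0 1) := by
  obtain ⟨C, hC⟩ := isCompact_Icc.exists_bound_of_continuousOn hA
  refine Integrable.mono' (hu.norm.const_mul C) ?_ ?_
  · exact (ContinuousLinearMap.apply ℝ E).flip.aestronglyMeasurable_comp₂
      (hA.aestronglyMeasurable measurableSet_Icc) hu.aestronglyMeasurable
  · filter_upwards [ae_restrict_mem measurableSet_Icc] with s hs
    exact (A s).le_of_opNorm_le (hC s hs) _

theorem norm_intervalIntegral_clm_apply_le {A : ℝ → V →L[ℝ] E} {u : ℝ → V}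
    (hu : IntegrableOn u (Icc 0 1)) {C : ℝ} (hC : ∀ s ∈ Icc (0 : ℝ) 1, ‖A s‖ ≤ C) {t : ℝ}
    (ht : t ∈ Icc (0 : ℝ) 1) :
    ‖∫ s in (0 : ℝ)..t, A s (u s)‖ ≤ C * ∫ s in Icc (0 : ℝ) 1, ‖u s‖ := by
  have hC0 : 0 ≤ C := (norm_nonneg _).trans (hC 0 (by simp))
  calc ‖∫ s in (0 : ℝ)..t, A s (u s)‖ ≤ ∫ s in (0 : ℝ)..t, C * ‖u s‖ := by
        refine intervalIntegral.norm_integral_le_of_norm_le ht.1 ?_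
          (IntegrableOn.intervalIntegrable_zero (hu.norm.const_mul C) ht)
        filter_upwards with s hs
        exact (A s).le_of_opNorm_le (hC s ⟨hs.1.le, hs.2.trans ht.2⟩) _
    _ = C * ∫ s in Ioc 0 t, ‖u s‖ := by
        rw [intervalIntegral.integral_const_mul, intervalIntegral.integral_of_le ht.1]
    _ ≤ C * ∫ s in Icc (0 : ℝ) 1, ‖u s‖ := by
        refine mul_le_mul_of_nonneg_left ?_ hC0
        refine setIntegral_mono_set hu.norm (Eventually.of_forall fun _ ↦ norm_nonneg _) ?_
        exact LE.le.eventuallyLE fun s hs ↦ ⟨hs.1.le, hs.2.trans ht.2⟩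

/-- Integrable controls on `[0,1]` with values in `V`. -/
abbrev L1Control (V : Type) [NormedAddCommGroup V] : Type :=
  Lp V 1 (volume.restrict (Icc (0 : ℝ) 1))

theorem L1Control.integrableOn (u : L1Control V) : IntegrableOn u (Icc 0 1) :=
  L1.integrable_coeFn u

theorem continuousOn_primitive_clm_apply {A : ℝ → V →L[ℝ] E} (hA : ContinuousOn A (Icc 0 1))
    {u : ℝ → V} (hu : IntegrableOn u (Icc 0 1)) :
    ContinuousOn (fun t ↦ ∫ s in (0 : ℝ)..t, A s (u s)) (Icc 0 1) := by
  have h := (IntegrableOn.clm_apply_of_continuousOn hA hu)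
  have := intervalIntegral.continuousOn_primitive_interval (a := 0) (b := 1) (μ := volume)
    (f := fun s ↦ A s (u s)) (by rwa [uIcc_of_le zero_le_one])
  rwa [uIcc_of_le zero_le_one] at this

theorem continuousOn_IccExtend (γ : C(unitInterval, E)) :
    ContinuousOn (IccExtend zero_le_one γ) (Icc (0 : ℝ) 1) :=
  (γ.continuous.Icc_extend').continuousOn

variable {F : Type} [NormedAddCommGroup F] [NormedSpace ℝ F]

theorem continuousOn_clm_comp_IccExtend (b : F →L[ℝ] V →L[ℝ] E) (A : C(unitInterval, F)) :
    ContinuousOn (fun s ↦ b (IccExtend zero_le_one A s)) (Icc (0 : ℝ) 1) :=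
  b.continuous.comp_continuousOn (continuousOn_IccExtend A)

/-- The primitive `t ↦ ∫₀ᵗ b(A(s)) u(s) ds` as a continuous function on `[0,1]`. -/
noncomputable def controlPrimitiveMap (b : F →L[ℝ] V →L[ℝ] E) (u : L1Control V)
    (A : C(unitInterval, F)) : C(unitInterval, E) where
  toFun t := ∫ s in (0 : ℝ)..t, b (IccExtend zero_le_one A s) (u s)
  continuous_toFun := (continuousOn_primitive_clm_apply (continuousOn_clm_comp_IccExtend b A)
    u.integrableOn).comp_continuous continuous_subtype_val fun t ↦ t.2

theorem controlPrimitiveMap_apply (b : F →L[ℝ] V →L[ℝ] E) (u : L1Control V)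
    (A : C(unitInterval, F)) (t : unitInterval) :
    controlPrimitiveMap b u A t = ∫ s in (0 : ℝ)..t, b (IccExtend zero_le_one A s) (u s) := rfl

theorem intervalIntegrable_clm_IccExtend (b : F →L[ℝ] V →L[ℝ] E) (u : L1Control V)
    (A : C(unitInterval, F)) (t : unitInterval) :
    IntervalIntegrable (fun s ↦ b (IccExtend zero_le_one A s) (u s)) volume 0 t :=
  IntegrableOn.intervalIntegrable_zero
    (IntegrableOn.clm_apply_of_continuousOn (continuousOn_clm_comp_IccExtend b A)
      u.integrableOn) t.2

/-- The primitive `t ↦ ∫₀ᵗ b(A(s)) u(s) ds`, bilinear in the control `u` and in the path `A`. -/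
noncomputable def controlPrimitive (b : F →L[ℝ] V →L[ℝ] E) :
    L1Control V →L[ℝ] C(unitInterval, F) →L[ℝ] C(unitInterval, E) :=
  LinearMap.mkContinuous₂
    (LinearMap.mk₂ ℝ (controlPrimitiveMap b)
      (fun u v A ↦ by
        ext t
        simp only [ContinuousMap.add_apply, controlPrimitiveMap_apply]
        rw [← intervalIntegral.integral_add (intervalIntegrable_clm_IccExtend b u A t)
          (intervalIntegrable_clm_IccExtend b v A t)]
        apply intervalIntegral.integral_congr_ae
        filter_upwards [ae_uIoc_of_ae_restrict (Lp.coeFn_add u v) t.2] with s hs hst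
        rw [hs hst, Pi.add_apply, map_add])
      (fun c u A ↦ by
        ext t
        simp only [ContinuousMap.smul_apply, controlPrimitiveMap_apply]
        rw [← intervalIntegral.integral_smul]
        apply intervalIntegral.integral_congr_ae
        filter_upwards [ae_uIoc_of_ae_restrict (Lp.coeFn_smul c u) t.2] with s hs hst
        rw [hs hst, Pi.smul_apply, map_smul])
      (fun u A B ↦ by
        ext t
        simp only [ContinuousMap.add_apply, controlPrimitiveMap_apply]
        rw [← intervalIntegral.integral_add (intervalIntegrable_clm_IccExtend b u A t)
          (intervalIntegrable_clm_IccExtend b u B t)]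
        congr 1 with s
        rw [← add_apply, ← map_add]
        rfl)
      (fun c u A ↦ by
        ext t
        simp only [ContinuousMap.smul_apply, controlPrimitiveMap_apply]
        rw [← intervalIntegral.integral_smul]
        congr 1 with s
        rw [← smul_apply, ← map_smul]
        rfl)) ‖b‖
    (fun u A ↦ by
      refine (ContinuousMap.norm_le _ (by positivity)).2 fun t ↦ ?_
      rw [mul_right_comm, L1.norm_eq_integral_norm u]
      exact norm_intervalIntegral_clm_apply_le u.integrableOn
        (fun s _ ↦ b.le_of_opNorm_le_of_le le_rfl (A.norm_coe_le_norm _)) t.2)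

theorem controlPrimitive_apply (b : F →L[ℝ] V →L[ℝ] E) (u : L1Control V) (A : C(unitInterval, F))
    (t : unitInterval) :
    controlPrimitive b u A t = ∫ s in (0 : ℝ)..t, b (IccExtend zero_le_one A s) (u s) := rfl

/-- `γ` is a solution in `M` on `[0,1]` of the integral equation `γ(t) = x + ∫₀ᵗ f(γ(s)) u(s) ds`. -/
structure IsIntegralSolution (M : Set E) (f : E → V →L[ℝ] E) (u : ℝ → V) (x : E) (γ : ℝ → E) :
    Prop where
  continuousOn : ContinuousOn γ (Icc 0 1)
  mem : ∀ t ∈ Icc (0 : ℝ) 1, γ t ∈ M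
  eq : ∀ t ∈ Icc (0 : ℝ) 1, γ t = x + ∫ s in (0 : ℝ)..t, f (γ s) (u s)

theorem IsIntegralSolution.initial {M : Set E} {f : E → V →L[ℝ] E} {u : ℝ → V} {x : E}
    {γ : ℝ → E} (h : IsIntegralSolution M f u x γ) : γ 0 = x := by
  simpa using h.eq 0 (by simp)

/-- The distance of two solutions satisfies a Volterra inequality with weight `|K| * ‖u s‖`. -/
theorem IsIntegralSolution.unique [CompleteSpace E] {M : Set E} {f : E → V →L[ℝ] E}
    (hf : ContinuousOn f M) {K : ℝ}
    (hK : ∀ p ∈ M, ∀ q ∈ M, ‖f p - f q‖ ≤ K * ‖p - q‖) {u : ℝ → V}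
    (hu : IntegrableOn u (Icc 0 1)) {x : E} {γ η : ℝ → E} (hγ : IsIntegralSolution M f u x γ)
    (hη : IsIntegralSolution M f u x η) : ∀ t ∈ Icc (0 : ℝ) 1, γ t = η t := by
  have hfγ : ContinuousOn (fun s ↦ f (γ s)) (Icc 0 1) := hf.comp hγ.continuousOn hγ.mem
  have hfη : ContinuousOn (fun s ↦ f (η s)) (Icc 0 1) := hf.comp hη.continuousOn hη.mem
  have ha : IntegrableOn (fun s ↦ |K| * ‖u s‖) (Icc 0 1) := hu.norm.const_mul _
  have h01 : (1 : ℝ) ∈ Icc (0 : ℝ) 1 := by simp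
  intro t ht
  have hδ : ContinuousOn (fun s ↦ ‖γ s - η s‖) (Icc 0 1) :=
    (hγ.continuousOn.sub hη.continuousOn).norm
  have := nonpos_of_le_volterra (IntegrableOn.intervalIntegrable_zero ha h01)
    (fun t ↦ by positivity) hδ (fun t ht ↦ ?_) t ht
  · exact sub_eq_zero.1 (norm_le_zero_iff.1 this)
  · have h1 := IntegrableOn.intervalIntegrable_zero (IntegrableOn.clm_apply_of_continuousOn hfγ hu) ht
    have h2 := IntegrableOn.intervalIntegrable_zero (IntegrableOn.clm_apply_of_continuousOn hfη hu) ht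
    rw [hγ.eq t ht, hη.eq t ht, add_sub_add_left_eq_sub, ← intervalIntegral.integral_sub h1 h2]
    refine intervalIntegral.norm_integral_le_of_norm_le ht.1 ?_
      ((IntegrableOn.intervalIntegrable_zero ha ht).mul_continuousOn (hδ.mono ?_))
    · filter_upwards with s hs
      have hs' : s ∈ Icc (0 : ℝ) 1 := ⟨hs.1.le, hs.2.trans ht.2⟩
      rw [← sub_apply]
      calc ‖(f (γ s) - f (η s)) (u s)‖ ≤ (|K| * ‖γ s - η s‖) * ‖u s‖ := by
            refine ContinuousLinearMap.le_of_opNorm_le _ ((hK _ (hγ.mem s hs') _ (hη.mem s hs')).trans ?_) _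
            gcongr
            exact le_abs_self K
        _ = |K| * ‖u s‖ * ‖γ s - η s‖ := by ring
    · rw [uIcc_of_le ht.1]
      exact Icc_subset_Icc_right ht.2

end IntegralEquation

/-! ### Local solvability and smooth dependence on control and initial value -/

section LocalFlow

open Set Filter Topology

variable {V E : Type} [NormedAddCommGroup V] [NormedSpace ℝ V] [NormedAddCommGroup E]
  [NormedSpace ℝ E] {F : Type} [NormedAddCommGroup F] [NormedSpace ℝ F]

/-- Some power of `W` has norm less than one, so `1 - W ^ n` is invertible by the Neumann series. As
`1 - W` is a factor of it, commuting with the cofactor, it is invertible too. -/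
theorem isUnit_one_sub_of_volterra [CompleteSpace E] (W : C(unitInterval, E) →L[ℝ] C(unitInterval, E))
    {a : ℝ → ℝ} (ha : IntervalIntegrable a volume 0 1) (hpos : ∀ t, 0 ≤ a t)
    (hW : ∀ (δ : C(unitInterval, E)) (t : unitInterval),
      ‖W δ t‖ ≤ ∫ s in (0 : ℝ)..t, a s * ‖IccExtend zero_le_one δ s‖) : IsUnit (1 - W) := by
  set G := ∫ s in (0 : ℝ)..1, a s with hG
  have hG0 : 0 ≤ G := intervalIntegral.integral_nonneg zero_le_one fun t _ ↦ hpos t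
  have hn : ∀ n : ℕ, ‖W ^ n‖ ≤ G ^ n / n.factorial := by
    intro n
    refine ContinuousLinearMap.opNorm_le_bound _ (by positivity) fun δ ↦ ?_
    refine (ContinuousMap.norm_le _ (by positivity)).2 fun t ↦ ?_
    have key := volterra_iterate_le ha hpos
      (δ := fun n s ↦ ‖IccExtend (zero_le_one' ℝ) ((W ^ n) δ) s‖)
      (fun n ↦ (continuousOn_IccExtend _).norm) (c := ‖δ‖)
      (fun t _ ↦ δ.norm_coe_le_norm _)
      (fun n s hs ↦ by
        have := hW ((W ^ n) δ) ⟨s, hs⟩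
        rw [← mul_apply_eq_comp, ← pow_succ'] at this
        rwa [IccExtend_of_mem _ _ hs]) n t t.2
    rw [IccExtend_val] at key
    calc ‖(W ^ n) δ t‖ ≤ _ := key
      _ ≤ ‖δ‖ * G ^ n / n.factorial := by
        gcongr
        · exact intervalIntegral.integral_nonneg t.2.1 fun t _ ↦ hpos t
        · exact primitive_le_of_nonneg ha hpos t.2
      _ = _ := by ring
  obtain ⟨n, hlt⟩ := ((FloorSemiring.tendsto_pow_div_factorial_atTop G).eventually
    (gt_mem_nhds one_pos)).exists
  have hu : IsUnit (1 - W ^ n) := isUnit_one_sub_of_norm_lt_one (R := C(unitInterval, E) →L[ℝ] C(unitInterval, E)) ((hn n).trans_lt hlt)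
  rw [← mul_neg_geom_sum] at hu
  refine ((Commute.isUnit_mul_iff ?_).1 hu).1
  exact Commute.sum_right _ _ _ fun i _ ↦
    (Commute.one_left _).sub_left ((Commute.refl W).pow_right i)

theorem isInvertible_of_isUnit {A : E →L[ℝ] E} (hA : IsUnit A) : A.IsInvertible := by
  obtain ⟨U, rfl⟩ := hA
  exact ⟨ContinuousLinearEquiv.unitsEquiv ℝ E U, rfl⟩

/-- The constant functions on the unit interval. -/
noncomputable def constPath (E : Type) [NormedAddCommGroup E] [NormedSpace ℝ E] :
    E →L[ℝ] C(unitInterval, E) :=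
  LinearMap.mkContinuous
    { toFun := ContinuousMap.const unitInterval
      map_add' := fun _ _ ↦ rfl
      map_smul' := fun _ _ ↦ rfl } 1
    (fun x ↦ by
      rw [one_mul]
      exact (ContinuousMap.norm_le _ (norm_nonneg x)).2 fun _ ↦ le_rfl)

@[simp]
theorem constPath_apply (x : E) (t : unitInterval) : constPath E x t = x := rfl

/-- The defect `γ - x - ∫₀ g(γ) u` of the controlled integral equation. -/
noncomputable def integralDefect (b : F →L[ℝ] V →L[ℝ] E) (g : C(E, F))
    (q : (L1Control V × E) × C(unitInterval, E)) : C(unitInterval, E) :=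
  q.2 - constPath E q.1.2 - controlPrimitive b q.1.1 (superposition unitInterval g q.2)

theorem contDiff_integralDefect (b : F →L[ℝ] V →L[ℝ] E) {g : C(E, F)} (hg : ContDiff ℝ ∞ g) :
    ContDiff ℝ ∞ (integralDefect b g) := by
  unfold integralDefect
  have h1 : ContDiff ℝ ∞ fun q : (L1Control V × E) × C(unitInterval, E) ↦
      superposition unitInterval g q.2 := (contDiff_superposition hg).comp contDiff_snd
  have h2 : ContDiff ℝ ∞ fun q : (L1Control V × E) × C(unitInterval, E) ↦
      controlPrimitive b q.1.1 :=
    ContDiff.comp (g := controlPrimitive b) (by fun_prop) contDiff_fst.fst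
  have h3 : ContDiff ℝ ∞ fun q : (L1Control V × E) × C(unitInterval, E) ↦ constPath E q.1.2 :=
    (constPath E).contDiff.comp contDiff_fst.snd
  exact (contDiff_snd.sub h3).sub (h2.clm_apply h1)

/-- Linearizing the defect in the path gives `1 - W`, where `W δ` is the primitive of `b (g'(γ) δ)
u`. This is a Volterra operator whose weight is a multiple of `‖u s‖`. -/
theorem isInvertible_fderiv_integralDefect_comp_inr [CompleteSpace E] (b : F →L[ℝ] V →L[ℝ] E) {g : C(E, F)}
    (hg : ContDiff ℝ ∞ g) (q : (L1Control V × E) × C(unitInterval, E)) :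
    (fderiv ℝ (integralDefect b g) q ∘L .inr ℝ (L1Control V × E) C(unitInterval, E)).IsInvertible := by
  let g' : C(E, E →L[ℝ] F) :=
    ⟨fderiv ℝ g, (hg.continuous_fderiv (by simp))⟩
  let D := superposition unitInterval g' q.2
  let W : C(unitInterval, E) →L[ℝ] C(unitInterval, E) :=
    controlPrimitive b q.1.1 ∘L pointwiseApply unitInterval E F D
  have h1 : HasFDerivAt (fun γ ↦ integralDefect b g (q.1, γ)) (1 - W) q.2 := by
    refine ((hasFDerivAt_id q.2).sub_const (constPath E q.1.2)).sub ?_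
    exact (controlPrimitive b q.1.1).hasFDerivAt.comp q.2
      (superposition_hasFDerivAt (f' := g')
        (fun p ↦ (hg.differentiable (by simp) p).hasFDerivAt) q.2)
  have h2 : HasFDerivAt (fun γ ↦ integralDefect b g (q.1, γ))
      (fderiv ℝ (integralDefect b g) q ∘L .inr ℝ (L1Control V × E) C(unitInterval, E)) q.2 :=
    HasFDerivAt.comp (g := integralDefect b g) (f := fun γ ↦ (q.1, γ)) q.2
      ((contDiff_integralDefect b hg).differentiable (by simp) q).hasFDerivAt
      (hasFDerivAt_prodMk_right q.1 q.2)
  rw [h2.unique h1]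
  refine isInvertible_of_isUnit (isUnit_one_sub_of_volterra W (a := fun s ↦ ‖b‖ * ‖D‖ * ‖q.1.1 s‖)
    (IntegrableOn.intervalIntegrable_zero (q.1.1.integrableOn.norm.const_mul _) (by simp))
    (fun t ↦ by positivity) fun δ t ↦ ?_)
  change ‖controlPrimitive b q.1.1 (pointwiseApply unitInterval E F D δ) t‖ ≤ _
  rw [controlPrimitive_apply]
  refine intervalIntegral.norm_integral_le_of_norm_le t.2.1 (Eventually.of_forall fun s _ ↦ ?_)
    ((IntegrableOn.intervalIntegrable_zero (q.1.1.integrableOn.norm.const_mul _)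
      t.2).mul_continuousOn (δ.continuous.Icc_extend'.norm.continuousOn))
  calc ‖b (IccExtend zero_le_one (pointwiseApply unitInterval E F D δ) s) (q.1.1 s)‖
      ≤ (‖b‖ * (‖D‖ * ‖IccExtend zero_le_one δ s‖)) * ‖q.1.1 s‖ := by
        refine ContinuousLinearMap.le_of_opNorm_le _ ?_ _
        refine b.le_of_opNorm_le_of_le le_rfl ?_
        exact ContinuousLinearMap.le_of_opNorm_le _ (D.norm_coe_le_norm _) _
    _ = _ := by ring

/-- The implicit function theorem solves the equation with `f` replaced by a globally smooth `g`.
For nearby data the solution path stays in an open set `O ⊆ M` on which `g = f`, so it solves the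
original equation. -/
theorem IsIntegralSolution.exists_contDiffAt [FiniteDimensional ℝ E] [CompleteSpace V] {M : Set E}
    (hM : IsOpen M) (b : F →L[ℝ] V →L[ℝ] E) {f : E → F} (hf : ContDiffOn ℝ ∞ f M) {u : L1Control V} {x : E}
    {γ : ℝ → E} (h : IsIntegralSolution M (fun p ↦ b (f p)) u x γ) :
    ∃ φ : L1Control V × E → C(unitInterval, E), ContDiffAt ℝ ∞ φ (u, x) ∧
      ∀ᶠ p in 𝓝 (u, x), IsIntegralSolution M (fun p ↦ b (f p)) p.1 p.2 (IccExtend zero_le_one (φ p)) := by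
  have : CompleteSpace E := FiniteDimensional.complete ℝ E
  let Γ : C(unitInterval, E) :=
    ⟨fun t ↦ γ t, h.continuousOn.comp_continuous continuous_subtype_val fun t ↦ t.2⟩
  have hK : IsCompact (range Γ) := isCompact_range Γ.continuous
  have hKM : range Γ ⊆ M := by
    rintro _ ⟨t, rfl⟩
    exact h.mem t t.2
  obtain ⟨g, hg, hgf⟩ := exists_contDiff_eq_nhdsSet hM hK hKM hf
  obtain ⟨O, hO, hKO, hOgf⟩ := (eventually_nhdsSet_iff_exists).1
    (hgf.and (hM.mem_nhdsSet.2 hKM))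
  let g₀ : C(E, F) := ⟨g, hg.continuous⟩
  have hcd : ContDiffAt ℝ ∞ (integralDefect b g₀) ((u, x), Γ) :=
    (contDiff_integralDefect b hg).contDiffAt
  have hinv := isInvertible_fderiv_integralDefect_comp_inr b (g := g₀) hg ((u, x), Γ)
  have hne : (∞ : WithTop ℕ∞) ≠ 0 := by simp
  have hzero : integralDefect b g₀ ((u, x), Γ) = 0 := by
    ext t
    change γ t - x - controlPrimitive b u (superposition unitInterval g₀ Γ) t = 0
    rw [controlPrimitive_apply, h.eq t t.2, add_sub_cancel_left, sub_eq_zero]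
    apply intervalIntegral.integral_congr_ae
    refine Eventually.of_forall fun s hs ↦ ?_
    have hs' := uIoc_zero_subset t.2 hs
    rw [IccExtend_of_mem _ _ hs']
    change b (f (γ s)) (u s) = b (g (γ s)) (u s)
    rw [(hOgf (γ s) (hKO ⟨⟨s, hs'⟩, rfl⟩)).1]
  set φ := hcd.implicitFunction hne hinv with hφ
  have hφs : ContDiffAt ℝ ∞ φ (u, x) := hcd.contDiffAt_implicitFunction hne hinv
  refine ⟨φ, hφs, ?_⟩
  have hφ0 : φ (u, x) = Γ := hcd.implicitFunction_apply_self hne hinv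
  -- Compactness of the interval makes staying in `O` an open condition on paths.
  have hOpen : IsOpen {η : C(unitInterval, E) | MapsTo η univ O} :=
    ContinuousMap.isOpen_setOfPred_mapsTo isCompact_univ hO
  have hev : ∀ᶠ p in 𝓝 (u, x), MapsTo (φ p) univ O :=
    hφs.continuousAt.eventually_mem (hOpen.mem_nhds (by
      rw [hφ0]
      exact fun t _ ↦ hKO ⟨t, rfl⟩))
  filter_upwards [hev, hcd.eventually_apply_implicitFunction hne hinv] with p hp hpe
  refine ⟨continuousOn_IccExtend _, fun t ht ↦ ?_, fun t ht ↦ ?_⟩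
  · rw [IccExtend_of_mem _ _ ht]
    exact (hOgf _ (hp (mem_univ _))).2
  · have hpt := congrArg (fun η : C(unitInterval, E) ↦ η ⟨t, ht⟩) (hpe.trans hzero)
    change φ p ⟨t, ht⟩ - p.2 -
      controlPrimitive b p.1 (superposition unitInterval g₀ (φ p)) ⟨t, ht⟩ = 0 at hpt
    rw [controlPrimitive_apply, sub_sub, sub_eq_zero] at hpt
    rw [IccExtend_of_mem _ _ ht, hpt]
    congr 1
    apply intervalIntegral.integral_congr_ae
    refine Eventually.of_forall fun s _ ↦ ?_
    change b (g _) _ = b (f _) _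
    rw [(hOgf _ (hp (mem_univ _))).1]
    rfl

end LocalFlow

/-! ### Concatenation and reversal of controls -/

section Reparametrization

open Set Filter Topology

variable {V E : Type} [NormedAddCommGroup V] [NormedSpace ℝ V] [NormedAddCommGroup E]
  [NormedSpace ℝ E]

theorem quasiMeasurePreserving_affine {a : ℝ} (ha : a ≠ 0) (c : ℝ) :
    Measure.QuasiMeasurePreserving (fun s : ℝ ↦ a * s + c) volume volume := by
  have h1 : Measure.QuasiMeasurePreserving (fun s : ℝ ↦ a * s) volume volume := by
    refine ⟨by fun_prop, ?_⟩
    rw [Real.map_volume_mul_left ha]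
    exact Measure.smul_absolutelyContinuous
  exact (measurePreserving_add_right volume c).quasiMeasurePreserving.comp h1

/-- The function `s ↦ a • u(a s + c)`, where `u` is extended by zero outside `[0,1]`. -/
noncomputable def affinePullback (a c : ℝ) (u : ℝ → V) (s : ℝ) : V :=
  a • (Icc (0 : ℝ) 1).indicator u (a * s + c)

theorem integrable_affinePullback {a : ℝ} (ha : a ≠ 0) (c : ℝ) {u : ℝ → V}
    (hu : IntegrableOn u (Icc 0 1)) : Integrable (affinePullback a c u) := by
  have h := (integrable_indicator_iff measurableSet_Icc).2 hu
  exact ((h.comp_add_right c).comp_mul_left' ha).smul a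

theorem integral_norm_affinePullback {a : ℝ} (ha : a ≠ 0) (c : ℝ) (u : ℝ → V) :
    ∫ s, ‖affinePullback a c u s‖ = ∫ s in Icc (0 : ℝ) 1, ‖u s‖ := by
  have h1 : ∀ s, ‖affinePullback a c u s‖ =
      |a| * (fun r ↦ (Icc (0 : ℝ) 1).indicator (fun s ↦ ‖u s‖) (r + c)) (a * s) := by
    intro s
    rw [affinePullback, norm_smul, Real.norm_eq_abs, norm_indicator_eq_indicator_norm]
  simp_rw [h1]
  rw [integral_const_mul, Measure.integral_comp_mul_left
    (fun r ↦ (Icc (0 : ℝ) 1).indicator (fun s ↦ ‖u s‖) (r + c)), integral_add_right_eq_self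
    (fun r ↦ (Icc (0 : ℝ) 1).indicator (fun s ↦ ‖u s‖) r), integral_indicator measurableSet_Icc,
    smul_eq_mul, ← mul_assoc, ← abs_mul, mul_inv_cancel₀ ha, abs_one, one_mul]

theorem affinePullback_congr {a : ℝ} (ha : a ≠ 0) (c : ℝ) {u v : ℝ → V}
    (h : u =ᵐ[volume.restrict (Icc (0 : ℝ) 1)] v) :
    affinePullback a c u =ᵐ[volume] affinePullback a c v := by
  have h1 : (Icc (0 : ℝ) 1).indicator u =ᵐ[volume] (Icc (0 : ℝ) 1).indicator v :=
    (ae_eq_restrict_iff_indicator_ae_eq measurableSet_Icc).1 h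
  filter_upwards [(quasiMeasurePreserving_affine ha c).ae h1] with s hs
  rw [affinePullback, affinePullback, hs]

/-- Affine reparametrization of controls. -/
noncomputable def L1Control.affine (a : ℝ) (ha : a ≠ 0) (c : ℝ) :
    L1Control V →L[ℝ] L1Control V :=
  LinearMap.mkContinuous
    { toFun := fun u ↦ (integrable_affinePullback ha c u.integrableOn).restrict.toL1
        (affinePullback a c u)
      map_add' := fun u v ↦ by
        rw [← Integrable.toL1_add, Integrable.toL1_eq_toL1_iff]
        filter_upwards [ae_restrict_of_ae (affinePullback_congr ha c (Lp.coeFn_add u v))] with s hs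
        rw [hs, Pi.add_apply, affinePullback, affinePullback, affinePullback, indicator_add',
          Pi.add_apply, smul_add]
      map_smul' := fun r u ↦ by
        rw [RingHom.id_apply, ← Integrable.toL1_smul, Integrable.toL1_eq_toL1_iff]
        filter_upwards [ae_restrict_of_ae (affinePullback_congr ha c (Lp.coeFn_smul r u))] with s hs
        rw [hs, affinePullback, affinePullback, Pi.smul_def, indicator_const_smul_apply,
          smul_comm] } 1
    (fun u ↦ by
      rw [one_mul]
      have h : ‖((integrable_affinePullback ha c u.integrableOn).restrict (s := Icc 0 1)).toL1
        (affinePullback a c u)‖ ≤ ‖u‖ := by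
        rw [L1.norm_eq_integral_norm, L1.norm_eq_integral_norm u,
          ← integral_norm_affinePullback ha c u]
        refine (integral_congr_ae ((Integrable.coeFn_toL1 _).fun_comp norm)).trans_le ?_
        exact setIntegral_le_integral (integrable_affinePullback ha c u.integrableOn).norm
          (Eventually.of_forall fun _ ↦ norm_nonneg _)
      exact h)

theorem L1Control.coeFn_affine {a : ℝ} (ha : a ≠ 0) (c : ℝ) (u : L1Control V) :
    L1Control.affine a ha c u =ᵐ[volume.restrict (Icc (0 : ℝ) 1)] affinePullback a c u :=
  Integrable.coeFn_toL1 (integrable_affinePullback ha c u.integrableOn).restrict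

/-- Concatenation of controls: first `p.1`, then `p.2`, at double speed. -/
noncomputable def L1Control.concat : L1Control V × L1Control V →L[ℝ] L1Control V :=
  L1Control.affine 2 two_ne_zero 0 ∘L .fst ℝ _ _ +
    L1Control.affine 2 two_ne_zero (-1) ∘L .snd ℝ _ _

/-- The time-reversed control. -/
noncomputable def L1Control.reverse (u : L1Control V) : L1Control V :=
  L1Control.affine (-1) (by norm_num) 1 u

theorem ae_ne_real (r : ℝ) : ∀ᵐ s : ℝ, s ≠ r :=
  compl_mem_ae_iff.2 (measure_singleton r)

theorem L1Control.concat_ae_left (u v : L1Control V) :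
    ∀ᵐ s : ℝ, s ∈ Icc (0 : ℝ) (1 / 2) → L1Control.concat (u, v) s = (2 : ℝ) • u (2 * s) := by
  have h1 := (ae_restrict_iff' measurableSet_Icc).1 (Lp.coeFn_add
    (L1Control.affine 2 two_ne_zero 0 u) (L1Control.affine 2 two_ne_zero (-1) v))
  have h2 := (ae_restrict_iff' measurableSet_Icc).1 (L1Control.coeFn_affine two_ne_zero 0 u)
  have h3 := (ae_restrict_iff' measurableSet_Icc).1 (L1Control.coeFn_affine two_ne_zero (-1) v)
  -- At `s = 1 / 2` both halves contribute, so this single point has to be discarded.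
  filter_upwards [h1, h2, h3, ae_ne_real (1 / 2)] with s h1 h2 h3 hne hs
  have hs' : s ∈ Icc (0 : ℝ) 1 := ⟨hs.1, by linarith [hs.2]⟩
  have hlt : s < 1 / 2 := lt_of_le_of_ne hs.2 hne
  refine (h1 hs').trans ?_
  rw [Pi.add_apply, h2 hs', h3 hs', affinePullback, affinePullback, add_zero,
    indicator_of_mem (show 2 * s ∈ Icc (0 : ℝ) 1 from ⟨by linarith [hs.1], by linarith⟩),
    indicator_of_notMem (fun h ↦ by linarith [h.1]), smul_zero, add_zero]

theorem L1Control.concat_ae_right (u v : L1Control V) :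
    ∀ᵐ s : ℝ, s ∈ Icc (1 / 2 : ℝ) 1 →
      L1Control.concat (u, v) s = (2 : ℝ) • v (2 * s - 1) := by
  have h1 := (ae_restrict_iff' measurableSet_Icc).1 (Lp.coeFn_add
    (L1Control.affine 2 two_ne_zero 0 u) (L1Control.affine 2 two_ne_zero (-1) v))
  have h2 := (ae_restrict_iff' measurableSet_Icc).1 (L1Control.coeFn_affine two_ne_zero 0 u)
  have h3 := (ae_restrict_iff' measurableSet_Icc).1 (L1Control.coeFn_affine two_ne_zero (-1) v)
  filter_upwards [h1, h2, h3, ae_ne_real (1 / 2)] with s h1 h2 h3 hne hs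
  have hs' : s ∈ Icc (0 : ℝ) 1 := ⟨by linarith [hs.1], hs.2⟩
  have hlt : 1 / 2 < s := lt_of_le_of_ne hs.1 hne.symm
  refine (h1 hs').trans ?_
  rw [Pi.add_apply, h2 hs', h3 hs', affinePullback, affinePullback, add_zero, ← sub_eq_add_neg,
    indicator_of_mem (show 2 * s - 1 ∈ Icc (0 : ℝ) 1 from ⟨by linarith, by linarith [hs.2]⟩),
    indicator_of_notMem (fun h ↦ by linarith [h.2]), smul_zero, zero_add]

theorem L1Control.reverse_ae (u : L1Control V) :
    ∀ᵐ s : ℝ, s ∈ Icc (0 : ℝ) 1 → L1Control.reverse u s = -u (1 - s) := by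
  have h := (ae_restrict_iff' measurableSet_Icc).1
    (L1Control.coeFn_affine (a := -1) (by norm_num) 1 u)
  filter_upwards [h] with s h hs
  refine (h hs).trans ?_
  rw [affinePullback, show -1 * s + 1 = 1 - s by ring,
    indicator_of_mem (show 1 - s ∈ Icc (0 : ℝ) 1 from ⟨by linarith [hs.2], by linarith [hs.1]⟩),
    neg_smul, one_smul]

/-- Concatenation of curves at double speed. -/
noncomputable def concatCurve {E : Type} (γ η : ℝ → E) (t : ℝ) : E :=
  if t ≤ 1 / 2 then γ (2 * t) else η (2 * t - 1)

theorem concatCurve_one {E : Type} (γ η : ℝ → E) : concatCurve γ η 1 = η 1 := by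
  rw [concatCurve, if_neg (by norm_num)]
  norm_num

theorem IsIntegralSolution.concat {M : Set E} {f : E → V →L[ℝ] E} (hf : ContinuousOn f M)
    {u v : L1Control V} {x : E} {γ η : ℝ → E} (hγ : IsIntegralSolution M f u x γ)
    (hη : IsIntegralSolution M f v (γ 1) η) :
    IsIntegralSolution M f (L1Control.concat (u, v)) x (concatCurve γ η) := by
  have hl : ∀ t ∈ Icc (0 : ℝ) (1 / 2), concatCurve γ η t = γ (2 * t) := fun t ht ↦ if_pos ht.2
  have hr : ∀ t ∈ Icc (1 / 2 : ℝ) 1, concatCurve γ η t = η (2 * t - 1) := by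
    intro t ht
    -- At the midpoint the definition takes the first curve; the second formula agrees there because
    -- `η` starts at `γ 1`.
    rcases eq_or_lt_of_le ht.1 with rfl | h
    · rw [concatCurve, if_pos le_rfl]
      norm_num
      exact hη.initial.symm
    · exact if_neg (not_le.2 h)
  have hml : MapsTo (fun t : ℝ ↦ 2 * t) (Icc 0 (1 / 2)) (Icc 0 1) := fun t ht ↦
    ⟨by linarith [ht.1], by linarith [ht.2]⟩
  have hmr : MapsTo (fun t : ℝ ↦ 2 * t - 1) (Icc (1 / 2) 1) (Icc 0 1) := fun t ht ↦
    ⟨by linarith [ht.1], by linarith [ht.2]⟩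
  have hcont : ContinuousOn (concatCurve γ η) (Icc 0 1) := by
    rw [← Icc_union_Icc_eq_Icc (by norm_num : (0 : ℝ) ≤ 1 / 2) (by norm_num)]
    refine ContinuousOn.union_of_isClosed ?_ ?_ isClosed_Icc isClosed_Icc
    · exact (hγ.continuousOn.comp (by fun_prop) hml).congr hl
    · exact (hη.continuousOn.comp (by fun_prop) hmr).congr hr
  have hmem : ∀ t ∈ Icc (0 : ℝ) 1, concatCurve γ η t ∈ M := by
    intro t ht
    rcases le_total t (1 / 2) with h | h
    · rw [hl t ⟨ht.1, h⟩]
      exact hγ.mem _ (hml ⟨ht.1, h⟩)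
    · rw [hr t ⟨h, ht.2⟩]
      exact hη.mem _ (hmr ⟨h, ht.2⟩)
  set w := L1Control.concat (u, v)
  have hil : ∀ t ∈ Icc (0 : ℝ) (1 / 2), ∫ s in (0 : ℝ)..t, f (concatCurve γ η s) (w s) =
      ∫ s in (0 : ℝ)..(2 * t), f (γ s) (u s) := by
    intro t ht
    have : ∫ s in (0 : ℝ)..t, f (concatCurve γ η s) (w s) =
        ∫ s in (0 : ℝ)..t, (2 : ℝ) • (fun r ↦ f (γ r) (u r)) (2 * s) := by
      apply intervalIntegral.integral_congr_ae
      filter_upwards [L1Control.concat_ae_left u v] with s hs hst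
      rw [uIoc_of_le ht.1] at hst
      have hs' : s ∈ Icc (0 : ℝ) (1 / 2) := ⟨hst.1.le, hst.2.trans ht.2⟩
      rw [hs hs', hl s hs', map_smul]
    rw [this, intervalIntegral.integral_smul, intervalIntegral.smul_integral_comp_mul_left
      (fun r ↦ f (γ r) (u r)), mul_zero]
  refine ⟨hcont, hmem, fun t ht ↦ ?_⟩
  rcases le_total t (1 / 2) with h | h
  · rw [hl t ⟨ht.1, h⟩, hil t ⟨ht.1, h⟩]
    exact hγ.eq _ (hml ⟨ht.1, h⟩)
  · have hint : IntervalIntegrable (fun s ↦ f (concatCurve γ η s) (w s)) volume 0 1 :=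
      IntegrableOn.intervalIntegrable_zero (IntegrableOn.clm_apply_of_continuousOn
        (hf.comp hcont hmem) w.integrableOn) (by simp)
    rw [← intervalIntegral.integral_add_adjacent_intervals (b := 1 / 2)
      (hint.mono_set (uIcc_subset_uIcc (by simp) (by rw [uIcc_of_le zero_le_one]; norm_num)))
      (hint.mono_set (uIcc_subset_uIcc (by rw [uIcc_of_le zero_le_one]; norm_num)
        (by rwa [uIcc_of_le zero_le_one]))), hil _ ⟨by norm_num, le_rfl⟩, ← add_assoc]
    have h1 : x + ∫ s in (0 : ℝ)..(2 * (1 / 2)), f (γ s) (u s) = γ 1 := by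
      rw [hγ.eq 1 (by simp)]
      norm_num
    have h2 : ∫ s in (1 / 2 : ℝ)..t, f (concatCurve γ η s) (w s) =
        ∫ s in (1 / 2 : ℝ)..t, (2 : ℝ) • (fun r ↦ f (η r) (v r)) (2 * s - 1) := by
      apply intervalIntegral.integral_congr_ae
      filter_upwards [L1Control.concat_ae_right u v] with s hs hst
      rw [uIoc_of_le h] at hst
      have hs' : s ∈ Icc (1 / 2 : ℝ) 1 := ⟨hst.1.le, hst.2.trans ht.2⟩
      rw [hs hs', hr s hs', map_smul]
    rw [h1, h2, intervalIntegral.integral_smul, intervalIntegral.smul_integral_comp_mul_sub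
      (fun r ↦ f (η r) (v r)),
      hr t ⟨h, ht.2⟩, hη.eq _ (hmr ⟨h, ht.2⟩)]
    norm_num

theorem IsIntegralSolution.reverse {M : Set E} {f : E → V →L[ℝ] E} (hf : ContinuousOn f M)
    {u : L1Control V} {x : E} {γ : ℝ → E} (hγ : IsIntegralSolution M f u x γ) :
    IsIntegralSolution M f (L1Control.reverse u) (γ 1) (fun t ↦ γ (1 - t)) := by
  have hm : MapsTo (fun t : ℝ ↦ 1 - t) (Icc 0 1) (Icc 0 1) := fun t ht ↦
    ⟨by linarith [ht.2], by linarith [ht.1]⟩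
  refine ⟨hγ.continuousOn.comp (by fun_prop) hm, fun t ht ↦ hγ.mem _ (hm ht), fun t ht ↦ ?_⟩
  have h2 : ∫ s in (0 : ℝ)..t, f (γ (1 - s)) (L1Control.reverse u s) =
      ∫ s in (0 : ℝ)..t, -(fun r ↦ f (γ r) (u r)) (1 - s) := by
    apply intervalIntegral.integral_congr_ae
    filter_upwards [L1Control.reverse_ae u] with s hs hst
    rw [hs (uIoc_zero_subset ht hst), map_neg]
  have hint : IntervalIntegrable (fun s ↦ f (γ s) (u s)) volume 0 1 :=
    IntegrableOn.intervalIntegrable_zero (IntegrableOn.clm_apply_of_continuousOn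
      (hf.comp hγ.continuousOn hγ.mem) u.integrableOn) (by simp)
  rw [h2, intervalIntegral.integral_neg, intervalIntegral.integral_comp_sub_left
    (fun r ↦ f (γ r) (u r)), sub_zero,
    hγ.eq _ (hm ht), hγ.eq 1 (by simp), ← intervalIntegral.integral_add_adjacent_intervals
      (a := 0) (b := 1 - t) (c := 1)
      (hint.mono_set (uIcc_subset_uIcc (by simp) (by rw [uIcc_of_le zero_le_one]; exact hm ht)))
      (hint.mono_set (uIcc_subset_uIcc (by rw [uIcc_of_le zero_le_one]; exact hm ht) (by simp)))]
  abel

end Reparametrization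

/-! ### Linear algebra of coordinate subspaces -/

section Coordinates

variable {m n : ℕ}

/-- The restriction of a vector to its first `n` coordinates. -/
noncomputable def coordRestrict (h : n ≤ m) :
    EuclideanSpace ℝ (Fin m) →L[ℝ] EuclideanSpace ℝ (Fin n) :=
  LinearMap.toContinuousLinearMap
    { toFun := fun w ↦ WithLp.toLp 2 fun i ↦ w (Fin.castLE h i)
      map_add' := fun _ _ ↦ rfl
      map_smul' := fun _ _ ↦ rfl }

/-- Extension of a vector by zero coordinates. -/
noncomputable def coordExtend (n m : ℕ) :
    EuclideanSpace ℝ (Fin n) →L[ℝ] EuclideanSpace ℝ (Fin m) :=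
  LinearMap.toContinuousLinearMap
    { toFun := fun s ↦ WithLp.toLp 2 fun j ↦ if hj : (j : ℕ) < n then s ⟨j, hj⟩ else 0
      map_add' := fun s t ↦ by
        ext j
        by_cases hj : (j : ℕ) < n <;> simp [hj]
      map_smul' := fun c s ↦ by
        ext j
        by_cases hj : (j : ℕ) < n <;> simp [hj] }

theorem coordRestrict_apply (h : n ≤ m) (w : EuclideanSpace ℝ (Fin m)) (i : Fin n) :
    coordRestrict h w i = w (Fin.castLE h i) := rfl

theorem coordExtend_apply (s : EuclideanSpace ℝ (Fin n)) (j : Fin m) :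
    coordExtend n m s j = if hj : (j : ℕ) < n then s ⟨j, hj⟩ else 0 := rfl

@[simp]
theorem coordRestrict_coordExtend (h : n ≤ m) (s : EuclideanSpace ℝ (Fin n)) :
    coordRestrict h (coordExtend n m s) = s := by
  ext i
  rw [coordRestrict_apply, coordExtend_apply, dif_pos (by simp)]
  rfl

/-- The projection to the last `m - n` coordinates. -/
noncomputable def coordNormal (h : n ≤ m) :
    EuclideanSpace ℝ (Fin m) →L[ℝ] EuclideanSpace ℝ (Fin m) :=
  .id ℝ _ - coordExtend n m ∘L coordRestrict h

theorem coordNormal_apply (h : n ≤ m) (w : EuclideanSpace ℝ (Fin m)) :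
    coordNormal h w = w - coordExtend n m (coordRestrict h w) := rfl

@[simp]
theorem coordNormal_coordExtend (h : n ≤ m) (s : EuclideanSpace ℝ (Fin n)) :
    coordNormal h (coordExtend n m s) = 0 := by
  rw [coordNormal_apply, coordRestrict_coordExtend, sub_self]

theorem coordExtend_coordRestrict (h : n ≤ m) {w : EuclideanSpace ℝ (Fin m)}
    (hw : coordNormal h w = 0) : coordExtend n m (coordRestrict h w) = w :=
  (sub_eq_zero.1 hw).symm

theorem coordNormal_eq_zero_iff (h : n ≤ m) (w : EuclideanSpace ℝ (Fin m)) :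
    coordNormal h w = 0 ↔ w ∈ coordinateSubspace m n := by
  constructor
  · intro hw j hj
    rw [← coordExtend_coordRestrict h hw, coordExtend_apply, dif_neg (not_lt.2 hj)]
  · intro hw
    ext j
    rw [coordNormal_apply, PiLp.sub_apply, coordExtend_apply]
    split_ifs with hj
    · simp [coordRestrict_apply]
    · simp [hw j (not_lt.1 hj)]

theorem coordExtend_injective (h : n ≤ m) : Function.Injective (coordExtend n m) :=
  Function.LeftInverse.injective (coordRestrict_coordExtend h)

theorem exists_linearEquiv_coordExtend_mem (h : n ≤ m)
    (W : Submodule ℝ (EuclideanSpace ℝ (Fin m))) (hW : Module.finrank ℝ W = n) :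
    ∃ T : EuclideanSpace ℝ (Fin m) ≃ₗ[ℝ] EuclideanSpace ℝ (Fin m),
      ∀ s : EuclideanSpace ℝ (Fin n), T (coordExtend n m s) ∈ W := by
  set R := (coordExtend n m : EuclideanSpace ℝ (Fin n) →ₗ[ℝ] EuclideanSpace ℝ (Fin m)).range
  have hR : Module.finrank ℝ R = n := by
    rw [LinearMap.finrank_range_of_inj (coordExtend_injective h), finrank_euclideanSpace_fin]
  obtain ⟨Q, hQ⟩ := W.exists_isCompl
  obtain ⟨P, hP⟩ := R.exists_isCompl
  have h1 := Submodule.finrank_add_eq_of_isCompl hQ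
  have h2 := Submodule.finrank_add_eq_of_isCompl hP
  let e₁ : R ≃ₗ[ℝ] W := LinearEquiv.ofFinrankEq R W (by omega)
  let e₂ : P ≃ₗ[ℝ] Q := LinearEquiv.ofFinrankEq P Q (by omega)
  refine ⟨(Submodule.prodEquivOfIsCompl R P hP).symm ≪≫ₗ (e₁.prodCongr e₂) ≪≫ₗ
    Submodule.prodEquivOfIsCompl W Q hQ, fun s ↦ ?_⟩
  let r : R := ⟨coordExtend n m s, s, rfl⟩
  have : (Submodule.prodEquivOfIsCompl R P hP).symm (coordExtend n m s) = (r, 0) :=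
    Submodule.prodEquivOfIsCompl_symm_apply_left _ _ hP r
  simp [this]

/-- Here `R` and `D` play the roles of the derivatives of the endpoint in the control and in the
initial value. Choose an automorphism `T` carrying `ℝⁿ × {0}` into the range of `R`. Let `A` lift
`T` through `R` on the first `n` coordinates and `C` lift it through `D` on the others; the sum is
then `T`. -/
theorem exists_transversal_parametrization {B : Type*} [NormedAddCommGroup B] [NormedSpace ℝ B]
    (h : n ≤ m) (R : B →L[ℝ] EuclideanSpace ℝ (Fin m))
    (hR : Module.finrank ℝ (R : B →ₗ[ℝ] EuclideanSpace ℝ (Fin m)).range = n)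
    {D D' : EuclideanSpace ℝ (Fin m) →L[ℝ] EuclideanSpace ℝ (Fin m)}
    (hD : D ∘L D' = .id ℝ _) :
    ∃ (A : EuclideanSpace ℝ (Fin m) →L[ℝ] B)
      (C : EuclideanSpace ℝ (Fin m) →L[ℝ] EuclideanSpace ℝ (Fin m)),
      (∀ s, C (coordExtend n m s) = 0) ∧ (R ∘L A + D ∘L C).IsInvertible := by
  obtain ⟨T, hT⟩ := exists_linearEquiv_coordExtend_mem h _ hR
  obtain ⟨g, hg⟩ := (R : B →ₗ[ℝ] EuclideanSpace ℝ (Fin m)).rangeRestrict.exists_rightInverse_of_surjective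
    (LinearMap.range_rangeRestrict _)
  let T' := T.toContinuousLinearEquiv
  let A₀ : EuclideanSpace ℝ (Fin n) →ₗ[ℝ] B :=
    g ∘ₗ ((T : EuclideanSpace ℝ (Fin m) →ₗ[ℝ] EuclideanSpace ℝ (Fin m)) ∘ₗ
      (coordExtend n m : EuclideanSpace ℝ (Fin n) →ₗ[ℝ] EuclideanSpace ℝ (Fin m))).codRestrict _ hT
  have hA₀ : ∀ s, R (A₀ s) = T (coordExtend n m s) := fun s ↦
    congrArg Subtype.val (LinearMap.congr_fun hg ⟨T (coordExtend n m s), hT s⟩)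
  refine ⟨A₀.toContinuousLinearMap ∘L coordRestrict h,
    D' ∘L (T' : EuclideanSpace ℝ (Fin m) →L[ℝ] EuclideanSpace ℝ (Fin m)) ∘L coordNormal h,
    fun s ↦ by simp, T', ?_⟩
  ext1 w
  have h1 : D (D' (T (coordNormal h w))) = T (coordNormal h w) :=
    congrArg (fun L : EuclideanSpace ℝ (Fin m) →L[ℝ] EuclideanSpace ℝ (Fin m) ↦
      L (T (coordNormal h w))) hD
  change T w = R (A₀ (coordRestrict h w)) + D (D' (T (coordNormal h w)))
  rw [h1, hA₀, ← map_add, coordNormal_apply, add_sub_cancel]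

end Coordinates

/-! ### Systems of endpoint maps -/

/-- A smooth family of endpoint maps `(u, x) ↦ End_x(u)`, defined on an open set of controls and
initial values, whose controls can be concatenated and reversed. -/
structure EndpointSystem (B E : Type*) [NormedAddCommGroup B] [NormedSpace ℝ B]
    [NormedAddCommGroup E] [NormedSpace ℝ E] where
  /-- The pairs of a control and an initial value for which the endpoint exists. -/
  dom : Set (B × E)
  /-- The endpoint of the trajectory. -/
  endpt : B × E → E
  isOpen_dom : IsOpen dom
  contDiffOn : ContDiffOn ℝ ∞ endpt dom
  /-- Concatenation of controls. -/
  concat : B × B →L[ℝ] B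
  concat_mem : ∀ {u v x}, (u, x) ∈ dom → (v, endpt (u, x)) ∈ dom → (concat (u, v), x) ∈ dom
  endpt_concat : ∀ {u v x}, (u, x) ∈ dom → (v, endpt (u, x)) ∈ dom →
    endpt (concat (u, v), x) = endpt (v, endpt (u, x))
  /-- Reversal of controls. -/
  reverse : B → B
  reverse_mem : ∀ {u x}, (u, x) ∈ dom → (reverse u, endpt (u, x)) ∈ dom
  endpt_reverse : ∀ {u x}, (u, x) ∈ dom → endpt (reverse u, endpt (u, x)) = x

namespace EndpointSystem

open Topology Filter

variable {B E : Type*} [NormedAddCommGroup B] [NormedSpace ℝ B]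
    [NormedAddCommGroup E] [NormedSpace ℝ E] (S : EndpointSystem B E)

/-- The set of all endpoints of trajectories starting at `x`. -/
def orbit (x : E) : Set E := {y | ∃ u, (u, x) ∈ S.dom ∧ S.endpt (u, x) = y}

variable {S}

theorem endpt_mem_orbit {u : B} {x : E} (h : (u, x) ∈ S.dom) : S.endpt (u, x) ∈ S.orbit x :=
  ⟨u, h, rfl⟩

theorem mem_orbit_symm {x y : E} (h : y ∈ S.orbit x) : x ∈ S.orbit y := by
  obtain ⟨u, hu, rfl⟩ := h
  exact ⟨S.reverse u, S.reverse_mem hu, S.endpt_reverse hu⟩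

theorem mem_orbit_trans {x y z : E} (hy : y ∈ S.orbit x) (hz : z ∈ S.orbit y) : z ∈ S.orbit x := by
  obtain ⟨u, hu, rfl⟩ := hy
  obtain ⟨v, hv, rfl⟩ := hz
  exact ⟨S.concat (u, v), S.concat_mem hu hv, S.endpt_concat hu hv⟩

variable (S)

/-- The derivative of the endpoint with respect to the control. -/
noncomputable def controlDeriv (u : B) (x : E) : B →L[ℝ] E :=
  fderiv ℝ S.endpt (u, x) ∘L .inl ℝ B E

/-- The derivative of the endpoint with respect to the initial value. -/
noncomputable def stateDeriv (u : B) (x : E) : E →L[ℝ] E :=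
  fderiv ℝ S.endpt (u, x) ∘L .inr ℝ B E

/-- The rank of the endpoint map of `x` at the control `u`. -/
noncomputable def controlRank (u : B) (x : E) : ℕ :=
  Module.finrank ℝ (S.controlDeriv u x : B →ₗ[ℝ] E).range

variable {S}

theorem contDiffAt_endpt {p : B × E} (h : p ∈ S.dom) : ContDiffAt ℝ ∞ S.endpt p :=
  S.contDiffOn.contDiffAt (S.isOpen_dom.mem_nhds h)

theorem hasFDerivAt_endpt {p : B × E} (h : p ∈ S.dom) :
    HasFDerivAt S.endpt (fderiv ℝ S.endpt p) p :=
  ((contDiffAt_endpt h).differentiableAt (by simp)).hasFDerivAt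

theorem fderiv_endpt_eq (u : B) (x : E) :
    fderiv ℝ S.endpt (u, x) = S.controlDeriv u x ∘L .fst ℝ B E + S.stateDeriv u x ∘L .snd ℝ B E := by
  refine ContinuousLinearMap.ext fun p ↦ ?_
  change _ = fderiv ℝ S.endpt (u, x) (p.1, 0) + fderiv ℝ S.endpt (u, x) (0, p.2)
  rw [← map_add]
  simp

theorem hasFDerivAt_control {u : B} {x : E} (h : (u, x) ∈ S.dom) :
    HasFDerivAt (fun v ↦ S.endpt (v, x)) (S.controlDeriv u x) u :=
  HasFDerivAt.comp (g := S.endpt) u (hasFDerivAt_endpt h) (hasFDerivAt_prodMk_left u x)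

theorem hasFDerivAt_state {u : B} {x : E} (h : (u, x) ∈ S.dom) :
    HasFDerivAt (fun z ↦ S.endpt (u, z)) (S.stateDeriv u x) x :=
  HasFDerivAt.comp (g := S.endpt) x (hasFDerivAt_endpt h) (hasFDerivAt_prodMk_right u x)

theorem eventually_control_mem {u : B} {x : E} (h : (u, x) ∈ S.dom) :
    ∀ᶠ v in 𝓝 u, (v, x) ∈ S.dom :=
  (Continuous.prodMk_left x).continuousAt.eventually_mem (S.isOpen_dom.mem_nhds h)

theorem eventually_state_mem {u : B} {x : E} (h : (u, x) ∈ S.dom) :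
    ∀ᶠ z in 𝓝 x, (u, z) ∈ S.dom :=
  (Continuous.prodMk_right u).continuousAt.eventually_mem (S.isOpen_dom.mem_nhds h)

theorem stateDeriv_reverse_comp {u : B} {x : E} (h : (u, x) ∈ S.dom) :
    S.stateDeriv (S.reverse u) (S.endpt (u, x)) ∘L S.stateDeriv u x = .id ℝ E := by
  have h1 := (hasFDerivAt_state (S.reverse_mem h)).comp x (hasFDerivAt_state h)
  refine h1.unique ((hasFDerivAt_id x).congr_of_eventuallyEq ?_)
  filter_upwards [eventually_state_mem h] with z hz using S.endpt_reverse hz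

/-- In finite dimension a one-sided inverse is two-sided. -/
theorem stateDeriv_comp_reverse [FiniteDimensional ℝ E] {u : B} {x : E} (h : (u, x) ∈ S.dom) :
    S.stateDeriv u x ∘L S.stateDeriv (S.reverse u) (S.endpt (u, x)) = .id ℝ E := by
  have h1 := congrArg ContinuousLinearMap.toLinearMap (stateDeriv_reverse_comp h)
  exact ContinuousLinearMap.coe_injective (mul_eq_one_comm.1 h1)

theorem stateDeriv_concat {u v : B} {x : E} (hu : (u, x) ∈ S.dom)
    (hv : (v, S.endpt (u, x)) ∈ S.dom) :
    S.stateDeriv (S.concat (u, v)) x = S.stateDeriv v (S.endpt (u, x)) ∘L S.stateDeriv u x := by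
  have h1 := (hasFDerivAt_state hv).comp x (hasFDerivAt_state hu)
  refine (hasFDerivAt_state (S.concat_mem hu hv)).unique (h1.congr_of_eventuallyEq ?_)
  filter_upwards [eventually_state_mem hu, (hasFDerivAt_state hu).continuousAt.eventually
    (eventually_state_mem hv)] with z hz hz' using S.endpt_concat hz hz'

/-- The identity `endpt_concat` is differentiated in both controls at once; `concat` is linear,
hence its own derivative. -/
theorem controlDeriv_concat {u v : B} {x : E} (hu : (u, x) ∈ S.dom)
    (hv : (v, S.endpt (u, x)) ∈ S.dom) (a b : B) :
    S.controlDeriv (S.concat (u, v)) x (S.concat (a, b)) =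
      S.stateDeriv v (S.endpt (u, x)) (S.controlDeriv u x a) +
        S.controlDeriv v (S.endpt (u, x)) b := by
  have h1 : HasFDerivAt (fun p : B × B ↦ S.endpt (S.concat p, x))
      (S.controlDeriv (S.concat (u, v)) x ∘L S.concat) (u, v) :=
    HasFDerivAt.comp (g := fun w ↦ S.endpt (w, x)) (u, v)
      (hasFDerivAt_control (S.concat_mem hu hv)) S.concat.hasFDerivAt
  have h2 : HasFDerivAt (fun p : B × B ↦ S.endpt (p.1, x))
      (S.controlDeriv u x ∘L .fst ℝ B B) (u, v) :=
    HasFDerivAt.comp (g := fun w ↦ S.endpt (w, x)) (f := Prod.fst) (u, v)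
      (hasFDerivAt_control hu) hasFDerivAt_fst
  have h3 : HasFDerivAt (fun p : B × B ↦ S.endpt (p.2, S.endpt (p.1, x)))
      (fderiv ℝ S.endpt (v, S.endpt (u, x)) ∘L
        ((ContinuousLinearMap.snd ℝ B B).prod (S.controlDeriv u x ∘L .fst ℝ B B))) (u, v) :=
    HasFDerivAt.comp (g := S.endpt) (f := fun p : B × B ↦ (p.2, S.endpt (p.1, x))) (u, v)
      (hasFDerivAt_endpt hv) (hasFDerivAt_snd.prodMk h2)
  have h4 := h1.unique (h3.congr_of_eventuallyEq ?_)
  · have h5 := congrArg (fun L : B × B →L[ℝ] E ↦ L (a, b)) h4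
    rw [fderiv_endpt_eq] at h5
    refine h5.trans ?_
    rw [add_comm]
    rfl
  · have hc : ContinuousAt (fun p : B × B ↦ (p.2, S.endpt (p.1, x))) (u, v) :=
      (hasFDerivAt_snd.prodMk h2).continuousAt
    filter_upwards [continuousAt_fst.eventually (eventually_control_mem hu),
      hc.eventually_mem (S.isOpen_dom.mem_nhds hv)] with p hp hp' using S.endpt_concat hp hp'

theorem controlRank_le [FiniteDimensional ℝ E] (u : B) (x : E) :
    S.controlRank u x ≤ Module.finrank ℝ E :=
  Submodule.finrank_le _

variable (S) in
/-- The maximal rank of the endpoint maps along the orbit of `x`. -/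
noncomputable def orbitRank (x : E) : ℕ :=
  sSup {n | ∃ y ∈ S.orbit x, ∃ u, (u, y) ∈ S.dom ∧ S.controlRank u y = n}

theorem controlRank_le_orbitRank [FiniteDimensional ℝ E] {x y : E} (hy : y ∈ S.orbit x) {u : B}
    (hu : (u, y) ∈ S.dom) : S.controlRank u y ≤ S.orbitRank x := by
  refine le_csSup ⟨Module.finrank ℝ E, ?_⟩ ⟨y, hy, u, hu, rfl⟩
  rintro _ ⟨y, -, u, -, rfl⟩
  exact controlRank_le u y

/-- Travel from `y` to a point where the maximal rank is attained, use the control attaining it, and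
return to `y`. The return has an invertible state derivative, so it does not lower the rank. -/
theorem exists_loop_controlRank_eq [FiniteDimensional ℝ E] {x y : E} (hy : y ∈ S.orbit x) :
    ∃ u, (u, y) ∈ S.dom ∧ S.endpt (u, y) = y ∧ S.controlRank u y = S.orbitRank x := by
  have hne : {n | ∃ y ∈ S.orbit x, ∃ u, (u, y) ∈ S.dom ∧ S.controlRank u y = n}.Nonempty := by
    obtain ⟨v, hv, -⟩ := mem_orbit_symm hy
    exact ⟨_, y, hy, v, hv, rfl⟩
  obtain ⟨z, hz, u, hu, hrank⟩ := Nat.sSup_mem hne ⟨Module.finrank ℝ E, by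
    rintro _ ⟨y, -, u, -, rfl⟩
    exact controlRank_le u y⟩
  obtain ⟨v, hv, hvz⟩ := mem_orbit_trans (mem_orbit_symm hy) hz
  obtain ⟨w, hw, hwy⟩ := mem_orbit_symm (mem_orbit_trans (mem_orbit_trans (mem_orbit_symm hy) hz)
    (endpt_mem_orbit hu))
  have huw := S.concat_mem hu hw
  have huwe := S.endpt_concat hu hw
  rw [← hvz] at huw
  refine ⟨S.concat (v, S.concat (u, w)), S.concat_mem hv huw, ?_, ?_⟩
  · rw [S.endpt_concat hv huw, hvz, huwe, hwy]
  · refine le_antisymm (controlRank_le_orbitRank hy (S.concat_mem hv huw)) ?_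
    have hinj : Function.Injective (S.stateDeriv w (S.endpt (u, z)) : E →ₗ[ℝ] E) :=
      Function.LeftInverse.injective (g := S.stateDeriv (S.reverse w) _) fun e ↦
        congrArg (fun L : E →L[ℝ] E ↦ L e) (stateDeriv_reverse_comp hw)
    have h1 : Submodule.map (S.stateDeriv w (S.endpt (u, z)) : E →ₗ[ℝ] E)
        (S.controlDeriv u z : B →ₗ[ℝ] E).range ≤
        (S.controlDeriv (S.concat (v, S.concat (u, w))) y : B →ₗ[ℝ] E).range := by
      rintro _ ⟨_, ⟨a, rfl⟩, rfl⟩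
      -- Only the middle, rank-maximizing piece of the loop is perturbed.
      refine ⟨S.concat (0, S.concat (a, 0)), ?_⟩
      refine (controlDeriv_concat hv huw 0 (S.concat (a, 0))).trans ?_
      rw [map_zero, map_zero, zero_add, hvz, controlDeriv_concat hu hw, map_zero, add_zero]
      rfl
    have h2 := Submodule.finrank_mono h1
    rw [← (Submodule.equivMapOfInjective _ hinj _).finrank_eq] at h2
    exact hrank.symm.le.trans h2

/-- Follow `u` by the detour back along `v` and forth again. The detour has state derivative the
identity, so the range for the long control contains the ranges for both `u` and `v`. Its rank
cannot exceed the maximum, so it equals the range for `v`. -/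
theorem range_controlDeriv_le [FiniteDimensional ℝ E] {x y z p : E} (hy : y ∈ S.orbit x)
    {u v : B} (hu : (u, y) ∈ S.dom) (hup : S.endpt (u, y) = p)
    (hv : (v, z) ∈ S.dom) (hvp : S.endpt (v, z) = p) (hrank : S.orbitRank x ≤ S.controlRank v z) :
    (S.controlDeriv u y : B →ₗ[ℝ] E).range ≤ (S.controlDeriv v z : B →ₗ[ℝ] E).range := by
  subst hup
  have hv' := S.reverse_mem hv
  have hv'' := hv
  rw [← S.endpt_reverse hv] at hv''
  rw [hvp] at hv' hv''
  have hw := S.concat_mem hv' hv''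
  have hsd : S.stateDeriv (S.concat (S.reverse v, v)) (S.endpt (u, y)) = .id ℝ E := by
    rw [stateDeriv_concat hv' hv'']
    have := stateDeriv_comp_reverse hv
    rw [hvp] at this
    rwa [show S.endpt (S.reverse v, S.endpt (u, y)) = z by rw [← hvp, S.endpt_reverse hv]]
  set U := S.concat (u, S.concat (S.reverse v, v)) with hU
  have h1 : (S.controlDeriv u y : B →ₗ[ℝ] E).range ≤ (S.controlDeriv U y : B →ₗ[ℝ] E).range := by
    rintro _ ⟨a, rfl⟩
    refine ⟨S.concat (a, 0), ?_⟩
    refine (controlDeriv_concat hu hw a 0).trans ?_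
    rw [hsd, map_zero, add_zero]
    rfl
  have h2 : (S.controlDeriv v z : B →ₗ[ℝ] E).range ≤ (S.controlDeriv U y : B →ₗ[ℝ] E).range := by
    rintro _ ⟨b, rfl⟩
    refine ⟨S.concat (0, S.concat (0, b)), ?_⟩
    refine (controlDeriv_concat hu hw 0 _).trans ?_
    rw [map_zero, map_zero, zero_add, controlDeriv_concat hv' hv'', map_zero, map_zero, zero_add,
      show S.endpt (S.reverse v, S.endpt (u, y)) = z by rw [← hvp, S.endpt_reverse hv]]
    rfl
  have h3 := Submodule.eq_of_le_of_finrank_le h2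
    ((controlRank_le_orbitRank hy (S.concat_mem hu hw)).trans hrank)
  rwa [h3]

end EndpointSystem

/-! ### Charts adapted to an orbit -/

section OrbitCharts

open Set Topology Filter Metric

/-- The inverse function theorem, with the domain shrunk to a ball: its convexity later supplies
straight segments to the centre. -/
theorem exists_openPartialHomeomorph_ball {E : Type*} [NormedAddCommGroup E] [NormedSpace ℝ E]
    [CompleteSpace E] {Φ : E → E} {O : Set E} (hO : O ∈ 𝓝 0)
    (hΦ : ∀ w ∈ O, ContDiffAt ℝ ∞ Φ w) (hinv : (fderiv ℝ Φ 0).IsInvertible) :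
    ∃ e : OpenPartialHomeomorph E E, (∃ r > 0, e.source = ball 0 r) ∧ e.source ⊆ O ∧
      (∀ w, e w = Φ w) ∧ (∀ w ∈ e.source, (fderiv ℝ Φ w).IsInvertible) ∧
      ContDiffOn ℝ ∞ e.symm e.target := by
  have h0 : ContDiffAt ℝ ∞ Φ 0 := hΦ 0 (mem_of_mem_nhds hO)
  obtain ⟨f', hf'⟩ := hinv
  have hd : HasFDerivAt Φ (f' : E →L[ℝ] E) 0 := by
    rw [hf']
    exact (h0.differentiableAt (by simp)).hasFDerivAt
  let e₀ := h0.toOpenPartialHomeomorph Φ hd (by simp)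
  have hs : e₀.source ∈ 𝓝 0 :=
    e₀.open_source.mem_nhds (h0.mem_toOpenPartialHomeomorph_source hd (by simp))
  have hi : ∀ᶠ w in 𝓝 0, (fderiv ℝ Φ w).IsInvertible := by
    have hc : ContinuousAt (fderiv ℝ Φ) 0 :=
      (h0.fderiv_right (m := ∞) (by simp)).continuousAt
    refine hc.eventually_mem (s := {L | L.IsInvertible}) ?_
    rw [← hf']
    exact ContinuousLinearEquiv.nhds f'
  obtain ⟨r, hr, hball⟩ := Metric.mem_nhds_iff.1 (inter_mem (inter_mem hO hs) hi)
  let e := e₀.restrOpen (ball 0 r) isOpen_ball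
  have hsource : e.source = ball 0 r := by
    rw [OpenPartialHomeomorph.restrOpen_source]
    exact inter_eq_right.2 fun w hw ↦ (hball hw).1.2
  refine ⟨e, ⟨r, hr, hsource⟩, ?_, fun w ↦ rfl, ?_, ?_⟩
  · rw [hsource]
    exact fun w hw ↦ (hball hw).1.1
  · rw [hsource]
    exact fun w hw ↦ (hball hw).2
  · intro p hp
    have hw : e.symm p ∈ ball 0 r := hsource ▸ e.map_target hp
    obtain ⟨g, hg⟩ := (hball hw).2
    have hcd := hΦ _ (hball hw).1.1
    refine (e.contDiffAt_symm (f₀' := g) hp ?_ hcd).contDiffWithinAt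
    rw [hg]
    exact (hcd.differentiableAt (by simp)).hasFDerivAt

/-- The map is locally constant, and countably many of the open sets on which it is constant cover
`Ω`. -/
theorem countable_image_of_hasFDerivAt_zero {B F : Type*} [NormedAddCommGroup B] [NormedSpace ℝ B]
    [SecondCountableTopology B] [NormedAddCommGroup F] [NormedSpace ℝ F] {Ω : Set B}
    (hΩ : IsOpen Ω) {β : B → F} (hβ : ∀ u ∈ Ω, HasFDerivAt β (0 : B →L[ℝ] F) u) :
    (β '' Ω).Countable := by
  have h1 : ∀ u ∈ Ω, {v | β v = β u} ∈ 𝓝[Ω] u := by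
    intro u hu
    obtain ⟨r, hr, hball⟩ := Metric.isOpen_iff.1 hΩ u hu
    refine mem_nhdsWithin_of_mem_nhds (mem_of_superset (ball_mem_nhds u hr) fun v hv ↦ ?_)
    exact (convex_ball u r).is_const_of_fderivWithin_eq_zero
      (fun z hz ↦ (hβ z (hball hz)).differentiableAt.differentiableWithinAt)
      (fun z hz ↦ by
        rw [fderivWithin_of_isOpen isOpen_ball hz, (hβ z (hball hz)).fderiv])
      hv (mem_ball_self hr)
  obtain ⟨t, -, htc, ht⟩ := TopologicalSpace.countable_cover_nhdsWithin h1
  refine (htc.image β).mono ?_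
  rintro _ ⟨v, hv, rfl⟩
  obtain ⟨u, hu, huv⟩ := mem_iUnion₂.1 (ht hv)
  exact ⟨u, hu, huv.symm⟩

/-- `e` is a parametrization, defined on a ball, of a neighborhood in `M` of the point `y` of `N`,
for which `N` contains the image of `ℝⁿ × {0}` and meets only countably many of the slices
`ℝⁿ × {b}`. -/
structure IsSliceParametrization {m n : ℕ} (h : n ≤ m) (M N : Set (EuclideanSpace ℝ (Fin m)))
    (y : EuclideanSpace ℝ (Fin m))
    (e : OpenPartialHomeomorph (EuclideanSpace ℝ (Fin m)) (EuclideanSpace ℝ (Fin m))) : Prop where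
  exists_source_eq_ball : ∃ r > 0, e.source = ball 0 r
  map_zero : e 0 = y
  target_subset : e.target ⊆ M
  contDiffOn : ContDiffOn ℝ ∞ e e.source
  contDiffOn_symm : ContDiffOn ℝ ∞ e.symm e.target
  slice_mem : ∀ w ∈ e.source, coordNormal h w = 0 → e w ∈ N
  countable : ((fun p ↦ coordNormal h (e.symm p)) '' (N ∩ e.target)).Countable

namespace EndpointSystem

variable {B : Type*} [NormedAddCommGroup B] [NormedSpace ℝ B]

theorem orbitRank_le {E : Type*} [NormedAddCommGroup E] [NormedSpace ℝ E] [FiniteDimensional ℝ E]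
    (S : EndpointSystem B E) (x : E) : S.orbitRank x ≤ Module.finrank ℝ E := by
  rcases isEmpty_or_nonempty (S.orbit x) with h | ⟨⟨y, hy⟩⟩
  · have : {n | ∃ y ∈ S.orbit x, ∃ u, (u, y) ∈ S.dom ∧ S.controlRank u y = n} = ∅ :=
      eq_empty_of_forall_notMem fun n ⟨y, hy, _⟩ ↦ h.elim ⟨y, hy⟩
    rw [orbitRank, this, csSup_empty]
    exact Nat.zero_le _
  · obtain ⟨u, -, -, hu⟩ := exists_loop_controlRank_eq hy
    rw [← hu]
    exact controlRank_le u y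

/-- The parametrization `Φ` perturbs the control and the initial point of a loop of maximal rank at
`y`. On `ℝⁿ × {0}` only the control moves, so the endpoint stays in the orbit. Countability of the
slices met by the orbit follows from the vanishing derivative of the normal coordinate. -/
theorem exists_isSliceParametrization [SecondCountableTopology B] {m : ℕ}
    {S : EndpointSystem B (EuclideanSpace ℝ (Fin m))} {x y : EuclideanSpace ℝ (Fin m)}
    (h : S.orbitRank x ≤ m) {M : Set (EuclideanSpace ℝ (Fin m))} (hM : IsOpen M)
    (hy : y ∈ S.orbit x) (hyM : y ∈ M) : ∃ e, IsSliceParametrization h M (S.orbit x) y e := by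
  obtain ⟨u, hu, huy, hrank⟩ := exists_loop_controlRank_eq hy
  have hD := stateDeriv_comp_reverse hu
  rw [huy] at hD
  obtain ⟨A, C, hC, hinv⟩ := exists_transversal_parametrization h (S.controlDeriv u y) hrank hD
  let q : EuclideanSpace ℝ (Fin m) → B × EuclideanSpace ℝ (Fin m) := fun w ↦ (u + A w, y + C w)
  have hq : ∀ w, HasFDerivAt q (A.prod C) w := fun w ↦
    (A.hasFDerivAt.const_add u).prodMk (C.hasFDerivAt.const_add y)
  have hqs : ContDiff ℝ ∞ q :=
    (contDiff_const.add A.contDiff).prodMk (contDiff_const.add C.contDiff)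
  let Φ := fun w ↦ S.endpt (q w)
  have hΦd : ∀ w, q w ∈ S.dom → HasFDerivAt Φ
      (S.controlDeriv (u + A w) (y + C w) ∘L A + S.stateDeriv (u + A w) (y + C w) ∘L C) w := by
    intro w hw
    have := (hasFDerivAt_endpt hw).comp w (hq w)
    rw [fderiv_endpt_eq] at this
    exact this
  have hΦs : ∀ w, q w ∈ S.dom → ContDiffAt ℝ ∞ Φ w := fun w hw ↦
    (contDiffAt_endpt hw).comp w hqs.contDiffAt
  have hq0 : q 0 = (u, y) := by simp [q]
  have hq0d : q 0 ∈ S.dom := hq0 ▸ hu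
  have hΦ0 : Φ 0 = y := by
    change S.endpt (q 0) = y
    rw [hq0, huy]
  have hO : {w | q w ∈ S.dom ∧ Φ w ∈ M} ∈ 𝓝 0 := by
    refine inter_mem ((hq 0).continuousAt.eventually_mem (S.isOpen_dom.mem_nhds hq0d)) ?_
    exact (hΦs 0 hq0d).continuousAt.eventually_mem (hM.mem_nhds (hΦ0.symm ▸ hyM))
  have hfd0 : (fderiv ℝ Φ 0).IsInvertible := by
    rw [(hΦd 0 hq0d).fderiv]
    simpa using hinv
  obtain ⟨e, hball, hsub, heΦ, hei, hes⟩ :=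
    exists_openPartialHomeomorph_ball hO (fun w hw ↦ hΦs w hw.1) hfd0
  refine ⟨e, hball, (heΦ 0).trans hΦ0, ?_, ?_, hes, ?_, ?_⟩
  · intro p hp
    rw [← e.right_inv hp, heΦ]
    exact (hsub (e.map_target hp)).2
  · intro w hw
    refine (ContDiffAt.congr_of_eventuallyEq (hΦs w (hsub hw).1) ?_).contDiffWithinAt
    exact Eventually.of_forall heΦ
  · intro w hw hw0
    have hCw : C w = 0 := by rw [← coordExtend_coordRestrict h hw0, hC]
    rw [heΦ]
    have hqw := (hsub hw).1
    have : q w = (u + A w, y) := by simp [q, hCw]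
    rw [this] at hqw
    change S.endpt (q w) ∈ _
    rw [this]
    exact mem_orbit_trans hy (endpt_mem_orbit hqw)
  · let Ω := {v | (v, x) ∈ S.dom ∧ S.endpt (v, x) ∈ e.target}
    have hΩ : IsOpen Ω := by
      rw [isOpen_iff_mem_nhds]
      rintro v ⟨hv, hvt⟩
      exact inter_mem (eventually_control_mem hv)
        ((hasFDerivAt_control hv).continuousAt.eventually_mem (e.open_target.mem_nhds hvt))
    refine (countable_image_of_hasFDerivAt_zero hΩ
      (β := fun v ↦ coordNormal h (e.symm (S.endpt (v, x)))) ?_).mono ?_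
    · rintro v ⟨hv, hvt⟩
      set w := e.symm (S.endpt (v, x)) with hw
      have hws : w ∈ e.source := e.map_target hvt
      have hwd := (hsub hws).1
      have hΦw : S.endpt (u + A w, y + C w) = S.endpt (v, x) := by
        change Φ w = _
        rw [← heΦ, hw, e.right_inv hvt]
      -- An endpoint system need not contain a constant trajectory; `x` is reached by going to `y`
      -- and back.
      have hxx : x ∈ S.orbit x := mem_orbit_trans hy (mem_orbit_symm hy)
      have hyw : y + C w ∈ S.orbit x :=
        mem_orbit_trans (endpt_mem_orbit hv) (mem_orbit_symm ⟨u + A w, hwd, hΦw⟩)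
      obtain ⟨L, hL⟩ := hei w hws
      have hLs : ∀ s : EuclideanSpace ℝ (Fin (S.orbitRank x)), L (coordExtend (S.orbitRank x) m s) =
          S.controlDeriv (u + A w) (y + C w) (A (coordExtend (S.orbitRank x) m s)) := by
        intro s
        have h1 := congrArg (fun T : EuclideanSpace ℝ (Fin m) →L[ℝ] EuclideanSpace ℝ (Fin m) ↦
          T (coordExtend (S.orbitRank x) m s)) (hL.trans (hΦd w hwd).fderiv)
        refine h1.trans ?_
        change _ + S.stateDeriv (u + A w) (y + C w) (C _) = _
        rw [hC, map_zero, add_zero]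
        rfl
      -- `J` spans the tangent space of the slice through `Φ w`. Being of rank `n` and contained in
      -- the range of a control derivative along the orbit, it fills that range.
      set J : EuclideanSpace ℝ (Fin (S.orbitRank x)) →ₗ[ℝ] EuclideanSpace ℝ (Fin m) :=
        (L : EuclideanSpace ℝ (Fin m) →ₗ[ℝ] EuclideanSpace ℝ (Fin m)) ∘ₗ
          (coordExtend (S.orbitRank x) m : _ →ₗ[ℝ] EuclideanSpace ℝ (Fin m)) with hJ
      have hJr : Module.finrank ℝ J.range = S.orbitRank x := by
        rw [LinearMap.finrank_range_of_inj, finrank_euclideanSpace_fin]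
        exact L.injective.comp (coordExtend_injective h)
      have hJle : J.range ≤ (S.controlDeriv (u + A w) (y + C w) :
          B →ₗ[ℝ] EuclideanSpace ℝ (Fin m)).range := by
        rintro _ ⟨s, rfl⟩
        exact ⟨A (coordExtend (S.orbitRank x) m s), (hLs s).symm⟩
      have hJeq := Submodule.eq_of_le_of_finrank_le hJle
        ((controlRank_le_orbitRank hyw hwd).trans hJr.symm.le)
      -- The controls `v` from `x` and `u + A w` from `y + C w` end at the same point, and the
      -- latter has maximal rank, so varying `v` moves the endpoint only tangentially to the slice.
      have hle := range_controlDeriv_le hxx hv rfl hwd hΦw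
        (hJr.symm.le.trans (Submodule.finrank_mono hJle))
      have hd1 : HasFDerivAt e.symm (L.symm : EuclideanSpace ℝ (Fin m) →L[ℝ] _)
          (S.endpt (v, x)) := by
        refine e.hasFDerivAt_symm hvt ?_
        refine HasFDerivAt.congr_of_eventuallyEq ?_ (Eventually.of_forall heΦ)
        rw [hL]
        exact (hΦd w hwd).differentiableAt.hasFDerivAt
      have hd2 := (coordNormal h).hasFDerivAt.comp v (hd1.comp v (hasFDerivAt_control hv))
      refine hd2.congr_fderiv ?_
      refine ContinuousLinearMap.ext fun a ↦ ?_
      have ha : S.controlDeriv v x a ∈ J.range := by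
        rw [hJeq]
        exact hle ⟨a, rfl⟩
      obtain ⟨s, hs⟩ := ha
      change coordNormal h (L.symm (S.controlDeriv v x a)) = 0
      rw [← hs]
      change coordNormal h (L.symm (L (coordExtend (S.orbitRank x) m s))) = 0
      rw [L.symm_apply_apply, coordNormal_coordExtend]
    · rintro _ ⟨_, ⟨⟨v, hv, rfl⟩, hvt⟩, rfl⟩
      exact ⟨v, ⟨hv, hvt⟩, rfl⟩

end EndpointSystem

end OrbitCharts

/-! ### The leaf topology and the manifold structure of an orbit -/

section Leaf

open Set Topology Filter Metric

variable {m n : ℕ} {h : n ≤ m} {M N : Set (EuclideanSpace ℝ (Fin m))}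

namespace IsSliceParametrization

variable {y : EuclideanSpace ℝ (Fin m)}
  {e : OpenPartialHomeomorph (EuclideanSpace ℝ (Fin m)) (EuclideanSpace ℝ (Fin m))}

theorem zero_mem_source (he : IsSliceParametrization h M N y e) : 0 ∈ e.source := by
  obtain ⟨r, hr, hs⟩ := he.exists_source_eq_ball
  rw [hs]
  exact mem_ball_self hr

theorem mem_target (he : IsSliceParametrization h M N y e) : y ∈ e.target :=
  he.map_zero ▸ e.map_source he.zero_mem_source

theorem symm_apply_base (he : IsSliceParametrization h M N y e) : e.symm y = 0 := by
  rw [← he.map_zero, e.left_inv he.zero_mem_source]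

/-- The normal coordinate maps a connected set continuously into a countable, hence totally
disconnected, set. -/
theorem coordNormal_eq_of_isPreconnected (he : IsSliceParametrization h M N y e) {Z : Type*}
    [TopologicalSpace Z] {f : Z → EuclideanSpace ℝ (Fin m)} {C : Set Z} (hC : IsPreconnected C)
    (hf : ContinuousOn f C) (hft : ∀ z ∈ C, f z ∈ N ∩ e.target) {z z' : Z} (hz : z ∈ C)
    (hz' : z' ∈ C) : coordNormal h (e.symm (f z)) = coordNormal h (e.symm (f z')) := by
  have hc : ContinuousOn (fun z ↦ coordNormal h (e.symm (f z))) C :=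
    (coordNormal h).continuous.comp_continuousOn
      (e.continuousOn_symm.comp hf fun z hz ↦ (hft z hz).2)
  refine he.countable.isTotallyDisconnected _ ?_ (hC.image _ hc) ⟨z, hz, rfl⟩ ⟨z', hz', rfl⟩
  rintro _ ⟨z, hz, rfl⟩
  exact ⟨f z, hft z hz, rfl⟩

theorem eventually_coordNormal_eq (he : IsSliceParametrization h M N y e) {Z : Type*}
    [TopologicalSpace Z] [LocallyConnectedSpace Z] {f : Z → EuclideanSpace ℝ (Fin m)} {O : Set Z}
    (hO : IsOpen O) (hf : ContinuousOn f O) (hfN : ∀ z ∈ O, f z ∈ N) {z₀ : Z} (hz₀ : z₀ ∈ O)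
    (ht : f z₀ ∈ e.target) :
    ∀ᶠ z in 𝓝 z₀, f z ∈ e.target ∧
      coordNormal h (e.symm (f z)) = coordNormal h (e.symm (f z₀)) := by
  have hO' : IsOpen (O ∩ f ⁻¹' e.target) := hf.isOpen_inter_preimage hO e.open_target
  have hsub := connectedComponentIn_subset (O ∩ f ⁻¹' e.target) z₀
  filter_upwards [connectedComponentIn_mem_nhds (hO'.mem_nhds ⟨hz₀, ht⟩)] with z hz
  refine ⟨(hsub hz).2, he.coordNormal_eq_of_isPreconnected isPreconnected_connectedComponentIn
    (hf.mono (hsub.trans inter_subset_left)) (fun z hz ↦ ⟨hfN z (hsub hz).1, (hsub hz).2⟩) hz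
    (mem_connectedComponentIn ⟨hz₀, ht⟩)⟩

end IsSliceParametrization

variable {L : Type*} {ι : L → EuclideanSpace ℝ (Fin m)}
  {e : L → OpenPartialHomeomorph (EuclideanSpace ℝ (Fin m)) (EuclideanSpace ℝ (Fin m))}

/-- The points of `L` of norm less than `ε` in the slice `ℝⁿ × {0}` of the parametrization `e`. -/
def slicePlaque (h : n ≤ m) (ι : L → EuclideanSpace ℝ (Fin m))
    (e : OpenPartialHomeomorph (EuclideanSpace ℝ (Fin m)) (EuclideanSpace ℝ (Fin m))) (ε : ℝ) :
    Set L :=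
  {p | ι p ∈ e.target ∧ e.symm (ι p) ∈ ball 0 ε ∧ coordNormal h (e.symm (ι p)) = 0}

/-- The topology on `L` in which the plaques around a point form a basis of neighborhoods. -/
@[reducible]
def leafTopology (h : n ≤ m) (ι : L → EuclideanSpace ℝ (Fin m))
    (e : L → OpenPartialHomeomorph (EuclideanSpace ℝ (Fin m)) (EuclideanSpace ℝ (Fin m))) :
    TopologicalSpace L where
  IsOpen V := ∀ y ∈ V, ∃ ε > 0, slicePlaque h ι (e y) ε ⊆ V
  isOpen_univ _ _ := ⟨1, one_pos, subset_univ _⟩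
  isOpen_inter V W hV hW y hy := by
    obtain ⟨ε, hε, hεV⟩ := hV y hy.1
    obtain ⟨δ, hδ, hδW⟩ := hW y hy.2
    exact ⟨min ε δ, lt_min hε hδ, fun p hp ↦
      ⟨hεV ⟨hp.1, ball_subset_ball (min_le_left _ _) hp.2.1, hp.2.2⟩,
        hδW ⟨hp.1, ball_subset_ball (min_le_right _ _) hp.2.1, hp.2.2⟩⟩⟩
  isOpen_sUnion 𝒱 h𝒱 y hy := by
    obtain ⟨V, hV, hyV⟩ := hy
    obtain ⟨ε, hε, hεV⟩ := h𝒱 V hV y hyV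
    exact ⟨ε, hε, hεV.trans (subset_sUnion_of_mem hV)⟩

/-- The point of `L` with slice coordinate `s` in the parametrization around `y`. -/
noncomputable def plaqueMap (n : ℕ) (ι : L → EuclideanSpace ℝ (Fin m))
    (e : L → OpenPartialHomeomorph (EuclideanSpace ℝ (Fin m)) (EuclideanSpace ℝ (Fin m))) (y : L)
    (s : EuclideanSpace ℝ (Fin n)) : L :=
  have : Nonempty L := ⟨y⟩
  Function.invFun ι (e y (coordExtend n m s))

theorem inclusion_plaqueMap (he : ∀ y, IsSliceParametrization h M (range ι) (ι y) (e y)) {y : L}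
    {s : EuclideanSpace ℝ (Fin n)} (hs : coordExtend n m s ∈ (e y).source) :
    ι (plaqueMap n ι e y s) = e y (coordExtend n m s) :=
  have : Nonempty L := ⟨y⟩
  Function.invFun_eq ((he y).slice_mem _ hs (coordNormal_coordExtend h s))

theorem isOpen_plaqueDomain (y : L) : IsOpen (coordExtend n m ⁻¹' (e y).source) :=
  (e y).open_source.preimage (coordExtend n m).continuous

theorem continuousOn_inclusion_plaqueMap
    (he : ∀ y, IsSliceParametrization h M (range ι) (ι y) (e y)) (y : L) :
    ContinuousOn (ι ∘ plaqueMap n ι e y) (coordExtend n m ⁻¹' (e y).source) :=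
  ((e y).continuousOn.comp (coordExtend n m).continuous.continuousOn fun _ hs ↦ hs).congr
    fun _ hs ↦ inclusion_plaqueMap he hs

theorem contDiffOn_slice (he : ∀ y, IsSliceParametrization h M (range ι) (ι y) (e y)) (y : L) :
    ContDiffOn ℝ ∞ (fun s ↦ e y (coordExtend n m s)) (coordExtend n m ⁻¹' (e y).source) :=
  (he y).contDiffOn.comp (coordExtend n m).contDiff.contDiffOn fun _ hs ↦ hs

theorem contDiffOn_sliceCoord (he : ∀ y, IsSliceParametrization h M (range ι) (ι y) (e y)) (y : L) :
    ContDiffOn ℝ ∞ (fun p ↦ coordRestrict h ((e y).symm p)) (e y).target :=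
  (coordRestrict h).contDiff.comp_contDiffOn (he y).contDiffOn_symm

/-! ### The manifold of leaves: continuity, charts, smoothness, separation and paracompactness. -/

variable [t : TopologicalSpace L]

theorem isOpen_leaf_iff (ht : t = leafTopology h ι e) {V : Set L} :
    IsOpen V ↔ ∀ y ∈ V, ∃ ε > 0, slicePlaque h ι (e y) ε ⊆ V := by
  subst ht
  exact Iff.rfl

/-- The key to initiality: on a small connected neighbourhood the normal coordinate cannot leave its
value 0 at `z₀`, so the map stays in the plaque around `f z₀`. -/
theorem continuousAt_leaf (ht : t = leafTopology h ι e)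
    (he : ∀ y, IsSliceParametrization h M (range ι) (ι y) (e y)) {Z : Type*} [TopologicalSpace Z]
    [LocallyConnectedSpace Z] {f : Z → L} {O : Set Z} (hO : IsOpen O)
    (hf : ContinuousOn (ι ∘ f) O) {z₀ : Z} (hz₀ : z₀ ∈ O) : ContinuousAt f z₀ := by
  rw [ContinuousAt, _root_.tendsto_nhds]
  intro V hV hz₀V
  obtain ⟨ε, hε, hεV⟩ := (isOpen_leaf_iff ht).1 hV _ hz₀V
  have heb := he (f z₀)
  have hc : ContinuousAt (fun z ↦ (e (f z₀)).symm (ι (f z))) z₀ :=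
    ((e (f z₀)).continuousAt_symm heb.mem_target).comp_of_eq
      (hf.continuousAt (hO.mem_nhds hz₀)) rfl
  filter_upwards [heb.eventually_coordNormal_eq hO hf (fun z _ ↦ ⟨f z, rfl⟩) hz₀ heb.mem_target,
    hc.eventually_mem (s := ball 0 ε) (by
      rw [heb.symm_apply_base]
      exact ball_mem_nhds _ hε)] with z hz hz'
  refine hεV ⟨hz.1, hz', hz.2.trans ?_⟩
  change coordNormal h ((e (f z₀)).symm (ι (f z₀))) = 0
  rw [heb.symm_apply_base, map_zero]

theorem continuous_leaf (ht : t = leafTopology h ι e)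
    (he : ∀ y, IsSliceParametrization h M (range ι) (ι y) (e y)) {Z : Type*} [TopologicalSpace Z]
    [LocallyConnectedSpace Z] {f : Z → L} (hf : Continuous (ι ∘ f)) : Continuous f :=
  continuous_iff_continuousAt.2 fun z ↦
    continuousAt_leaf ht he isOpen_univ hf.continuousOn (mem_univ z)

theorem continuous_leaf_inclusion (ht : t = leafTopology h ι e)
    (he : ∀ y, IsSliceParametrization h M (range ι) (ι y) (e y)) : Continuous ι := by
  refine continuous_def.2 fun U hU ↦ ?_
  refine (isOpen_leaf_iff ht).2 fun y hy ↦ ?_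
  have heb := he y
  have hc : ContinuousAt (e y) 0 := (e y).continuousAt heb.zero_mem_source
  obtain ⟨ε, hε, hball⟩ := Metric.mem_nhds_iff.1
    (hc.preimage_mem_nhds (hU.mem_nhds (heb.map_zero.symm ▸ hy)))
  refine ⟨ε, hε, fun p hp ↦ ?_⟩
  have := hball hp.2.1
  rwa [mem_preimage, (e y).right_inv hp.1] at this

/-- Basic neighbourhoods of `z` are cut out by the parametrization at `z`, not the one at `y`. Near
`z`, the plaque of `z` is a continuous image of an open set of `ℝⁿ`, which is locally connected, so
its normal coordinate in the parametrization at `y` is constantly 0. -/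
theorem isOpen_plaque (ht : t = leafTopology h ι e) (hι : Function.Injective ι)
    (he : ∀ y, IsSliceParametrization h M (range ι) (ι y) (e y)) (y : L) :
    IsOpen {p | ι p ∈ (e y).target ∧ coordNormal h ((e y).symm (ι p)) = 0} := by
  refine (isOpen_leaf_iff ht).2 fun z ⟨hzt, hz0⟩ ↦ ?_
  have hez := he z
  have h0 : (0 : EuclideanSpace ℝ (Fin n)) ∈ coordExtend n m ⁻¹' (e z).source := by
    rw [mem_preimage, map_zero]
    exact hez.zero_mem_source
  have hbase : ι (plaqueMap n ι e z 0) = ι z := by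
    rw [inclusion_plaqueMap he h0, map_zero, hez.map_zero]
  have hev := (he y).eventually_coordNormal_eq (isOpen_plaqueDomain z)
    (continuousOn_inclusion_plaqueMap he z) (fun s _ ↦ ⟨_, rfl⟩) h0
    (by rwa [Function.comp_apply, hbase])
  rw [Function.comp_apply, hbase, hz0] at hev
  have hc : Tendsto (coordRestrict h) (𝓝 0) (𝓝 0) := by
    simpa using (coordRestrict h).continuous.tendsto 0
  obtain ⟨ε, hε, hball⟩ := Metric.eventually_nhds_iff_ball.1 (hc.eventually hev)
  refine ⟨ε, hε, fun p hp ↦ ?_⟩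
  have hw := coordExtend_coordRestrict h hp.2.2
  have hp' : plaqueMap n ι e z (coordRestrict h ((e z).symm (ι p))) = p := by
    apply hι
    rw [inclusion_plaqueMap he (by rw [hw]; exact (e z).map_target hp.1), hw,
      (e z).right_inv hp.1]
  have := hball _ hp.2.1
  rwa [Function.comp_apply, hp'] at this

/-- The chart of `L` around `y` given by the slice coordinates. -/
noncomputable def leafChart (ht : t = leafTopology h ι e) (hι : Function.Injective ι)
    (he : ∀ y, IsSliceParametrization h M (range ι) (ι y) (e y)) (y : L) :
    OpenPartialHomeomorph L (EuclideanSpace ℝ (Fin n)) where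
  toFun p := coordRestrict h ((e y).symm (ι p))
  invFun := plaqueMap n ι e y
  source := {p | ι p ∈ (e y).target ∧ coordNormal h ((e y).symm (ι p)) = 0}
  target := coordExtend n m ⁻¹' (e y).source
  map_source' p hp := by
    rw [mem_preimage, coordExtend_coordRestrict h hp.2]
    exact (e y).map_target hp.1
  map_target' s hs := by
    have hs' : coordExtend n m s ∈ (e y).source := hs
    refine ⟨?_, ?_⟩ <;> rw [inclusion_plaqueMap he hs]
    · exact (e y).map_source hs'
    · rw [(e y).left_inv hs', coordNormal_coordExtend]
  left_inv' p hp := by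
    have hw := coordExtend_coordRestrict h hp.2
    apply hι
    rw [inclusion_plaqueMap he (by rw [hw]; exact (e y).map_target hp.1), hw,
      (e y).right_inv hp.1]
  right_inv' s hs := by
    have hs' : coordExtend n m s ∈ (e y).source := hs
    rw [inclusion_plaqueMap he hs, (e y).left_inv hs', coordRestrict_coordExtend]
  open_source := isOpen_plaque ht hι he y
  open_target := isOpen_plaqueDomain y
  continuousOn_toFun := (coordRestrict h).continuous.comp_continuousOn
    ((e y).continuousOn_symm.comp (continuous_leaf_inclusion ht he).continuousOn fun _ hp ↦ hp.1)
  continuousOn_invFun _ hs := (continuousAt_leaf ht he (isOpen_plaqueDomain y)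
    (continuousOn_inclusion_plaqueMap he y) hs).continuousWithinAt

theorem mem_leafChart_source (ht : t = leafTopology h ι e) (hι : Function.Injective ι)
    (he : ∀ y, IsSliceParametrization h M (range ι) (ι y) (e y)) (y : L) :
    y ∈ (leafChart ht hι he y).source :=
  ⟨(he y).mem_target, by rw [(he y).symm_apply_base, map_zero]⟩

/-- The charted space structure on `L` given by the slice coordinates. -/
@[reducible]
noncomputable def leafChartedSpace (ht : t = leafTopology h ι e) (hι : Function.Injective ι)
    (he : ∀ y, IsSliceParametrization h M (range ι) (ι y) (e y)) :
    ChartedSpace (EuclideanSpace ℝ (Fin n)) L where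
  atlas := range (leafChart ht hι he)
  chartAt := leafChart ht hι he
  mem_chart_source := mem_leafChart_source ht hι he
  chart_mem_atlas := mem_range_self

theorem isManifold_leaf (ht : t = leafTopology h ι e) (hι : Function.Injective ι)
    (he : ∀ y, IsSliceParametrization h M (range ι) (ι y) (e y)) :
    letI := leafChartedSpace ht hι he
    IsManifold (𝓡 n) ∞ L := by
  let := leafChartedSpace ht hι he
  refine isManifold_of_contDiffOn (𝓡 n) ∞ L ?_
  rintro _ _ ⟨y, rfl⟩ ⟨z, rfl⟩
  simp only [modelWithCornersSelf_coe, modelWithCornersSelf_coe_symm, Function.id_comp,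
    Function.comp_id, preimage_id_eq, id_eq, range_id, inter_univ]
  rw [OpenPartialHomeomorph.trans_source]
  have hmem : ∀ s ∈ (leafChart ht hι he y).symm.source ∩
      (leafChart ht hι he y).symm ⁻¹' (leafChart ht hι he z).source,
      e y (coordExtend n m s) ∈ (e z).target := by
    rintro s ⟨hs, hsz⟩
    rw [← inclusion_plaqueMap he hs]
    exact hsz.1
  refine (((contDiffOn_sliceCoord he z).comp ((contDiffOn_slice he y).mono fun s hs ↦ hs.1)
    hmem)).congr ?_
  rintro s ⟨hs, hsz⟩
  change coordRestrict h ((e z).symm (ι (plaqueMap n ι e y s))) = _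
  rw [inclusion_plaqueMap he hs]
  rfl

theorem contMDiff_leaf_inclusion (ht : t = leafTopology h ι e) (hι : Function.Injective ι)
    (he : ∀ y, IsSliceParametrization h M (range ι) (ι y) (e y)) :
    letI := leafChartedSpace ht hι he
    ContMDiff (𝓡 n) (𝓡 m) ∞ ι := by
  let := leafChartedSpace ht hι he
  have := isManifold_leaf ht hι he
  intro y
  have hsource := mem_leafChart_source ht hι he y
  have h1 : ContMDiffAt (𝓡 n) (𝓡 n) ∞ (leafChart ht hι he y) y :=
    contMDiffAt_of_mem_maximalAtlas
      (IsManifold.subset_maximalAtlas (I := 𝓡 n) (n := ∞) ⟨y, rfl⟩) hsource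
  have h2 : ContDiffAt ℝ ∞ (fun s ↦ e y (coordExtend n m s)) (leafChart ht hι he y y) :=
    (contDiffOn_slice he y).contDiffAt
      ((isOpen_plaqueDomain y).mem_nhds ((leafChart ht hι he y).map_source hsource))
  refine (h2.contMDiffAt.comp y h1).congr_of_eventuallyEq ?_
  filter_upwards [(leafChart ht hι he y).open_source.mem_nhds hsource] with p hp
  change _ = e y (coordExtend n m (coordRestrict h ((e y).symm (ι p))))
  rw [coordExtend_coordRestrict h hp.2, (e y).right_inv hp.1]

/-- Continuity into the leaf topology comes from local connectedness of `Z`. Once it is known,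
smoothness in a leaf chart follows from applying the smooth slice coordinates to `ι ∘ f`. -/
theorem contMDiff_leaf (ht : t = leafTopology h ι e) (hι : Function.Injective ι)
    (he : ∀ y, IsSliceParametrization h M (range ι) (ι y) (e y)) {d : ℕ} {Z : Type*}
    [TopologicalSpace Z] [ChartedSpace (EuclideanSpace ℝ (Fin d)) Z] {f : Z → L}
    (hf : ContMDiff (𝓡 d) (𝓡 m) ∞ (ι ∘ f)) :
    letI := leafChartedSpace ht hι he
    ContMDiff (𝓡 d) (𝓡 n) ∞ f := by
  let := leafChartedSpace ht hι he
  have : LocallyConnectedSpace Z :=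
    ChartedSpace.locallyConnectedSpace (EuclideanSpace ℝ (Fin d)) Z
  have hfc : Continuous f := continuous_leaf ht he hf.continuous
  intro z
  rw [contMDiffAt_iff_target]
  refine ⟨hfc.continuousAt, ?_⟩
  have h1 : ContDiffAt ℝ ∞ (fun p ↦ coordRestrict h ((e (f z)).symm p)) ((ι ∘ f) z) :=
    (contDiffOn_sliceCoord he (f z)).contDiffAt
      ((e (f z)).open_target.mem_nhds (he (f z)).mem_target)
  exact h1.contMDiffAt.comp z (hf z)

/-- Slice coordinates composed with `g` are smooth near `j y`, and their composite with `j` is the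
leaf chart. The invertible derivative of the chart therefore factors through that of `j`. -/
theorem mfderiv_injective_of_factor (ht : t = leafTopology h ι e) (hι : Function.Injective ι)
    (he : ∀ y, IsSliceParametrization h M (range ι) (ι y) (e y)) {Y : Type*}
    [TopologicalSpace Y] [ChartedSpace (EuclideanSpace ℝ (Fin m)) Y] {j : L → Y}
    {g : Y → EuclideanSpace ℝ (Fin m)} (hg : ContMDiff (𝓡 m) (𝓡 m) ∞ g) (hgj : ∀ p, g (j p) = ι p)
    (hj : letI := leafChartedSpace ht hι he
      ContMDiff (𝓡 n) (𝓡 m) ∞ j) (y : L) :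
    letI := leafChartedSpace ht hι he
    Function.Injective (mfderiv (𝓡 n) (𝓡 m) j y) := by
  let := leafChartedSpace ht hι he
  have := isManifold_leaf ht hι he
  have : IsManifold (𝓡 n) 1 L := IsManifold.of_le (n := ∞) (by simp)
  have h1 : ContDiffAt ℝ ∞ (fun p ↦ coordRestrict h ((e y).symm p)) (g (j y)) := by
    rw [hgj]
    exact (contDiffOn_sliceCoord he y).contDiffAt ((e y).open_target.mem_nhds (he y).mem_target)
  have h2 : ContMDiffAt (𝓡 m) (𝓡 n) ∞ (fun p ↦ coordRestrict h ((e y).symm (g p))) (j y) :=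
    h1.contMDiffAt.comp (j y) (hg (j y))
  have hchart : (fun p ↦ coordRestrict h ((e y).symm (g p))) ∘ j = extChartAt (𝓡 n) y := by
    funext p
    change coordRestrict h ((e y).symm (g (j p))) = coordRestrict h ((e y).symm (ι p))
    rw [hgj]
  have h3 := mfderiv_comp y (h2.mdifferentiableAt (by simp)) ((hj y).mdifferentiableAt (by simp))
  rw [hchart] at h3
  have h4 := (isInvertible_mfderiv_extChartAt (I := 𝓡 n) (mem_extChartAt_source y)).injective
  rw [h3] at h4
  exact Function.Injective.of_comp h4

theorem t2Space_leaf (ht : t = leafTopology h ι e) (hι : Function.Injective ι)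
    (he : ∀ y, IsSliceParametrization h M (range ι) (ι y) (e y)) : T2Space L :=
  T2Space.of_injective_continuous hι (continuous_leaf_inclusion ht he)

/-- The map `g` is continuous even for the leaf topology, so `L` is Lindelöf. Countably many charts
then cover it, which makes it second countable, besides being locally compact and Hausdorff. -/
theorem paracompactSpace_leaf (ht : t = leafTopology h ι e) (hι : Function.Injective ι)
    (he : ∀ y, IsSliceParametrization h M (range ι) (ι y) (e y)) {Y : Type*} [TopologicalSpace Y]
    [SecondCountableTopology Y] [LocallyConnectedSpace Y] {g : Y → L}
    (hg : Function.Surjective g) (hgc : Continuous (ι ∘ g)) : ParacompactSpace L := by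
  let := leafChartedSpace ht hι he
  have hgc' : Continuous g := continuous_leaf ht he hgc
  have hlin : IsLindelof (univ : Set L) := by
    rw [← hg.range_eq, ← image_univ]
    exact isLindelof_univ.image hgc'
  obtain ⟨c, hc, -, hcov⟩ := hlin.elim_nhds_subcover
    (fun y ↦ (chartAt (EuclideanSpace ℝ (Fin n)) y).source) fun y _ ↦ chart_source_mem_nhds _ y
  have : SecondCountableTopology L :=
    ChartedSpace.secondCountable_of_countable_cover (EuclideanSpace ℝ (Fin n))
      (univ_subset_iff.1 hcov) hc
  have : LocallyCompactSpace L := ChartedSpace.locallyCompactSpace (EuclideanSpace ℝ (Fin n)) L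
  have := t2Space_leaf ht hι he
  infer_instance

end Leaf

/-! ### The endpoint system of a controlled differential equation -/

section ControlledEquation

open Set Filter Topology

section System

variable {V E : Type} [NormedAddCommGroup V] [NormedSpace ℝ V] [NormedAddCommGroup E]
  [NormedSpace ℝ E]

/-- The pairs of a control and an initial value whose integral equation is solvable. -/
def integralDomain (M : Set E) (f : E → V →L[ℝ] E) : Set (L1Control V × E) :=
  {p | ∃ γ, IsIntegralSolution M f p.1 p.2 γ}

open Classical in
/-- The endpoint of a solution of the integral equation. -/
noncomputable def integralEndpoint (M : Set E) (f : E → V →L[ℝ] E) (p : L1Control V × E) : E :=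
  -- The value off the domain is immaterial: all axioms of an endpoint system concern points of the
  -- domain.
  if hp : p ∈ integralDomain M f then hp.choose 1 else p.2

variable {M : Set E} {f : E → V →L[ℝ] E} {K : ℝ}

theorem integralEndpoint_eq [CompleteSpace E] (hf : ContinuousOn f M)
    (hK : ∀ p ∈ M, ∀ q ∈ M, ‖f p - f q‖ ≤ K * ‖p - q‖) {u : L1Control V} {x : E} {γ : ℝ → E}
    (hγ : IsIntegralSolution M f u x γ) : integralEndpoint M f (u, x) = γ 1 := by
  have hp : (u, x) ∈ integralDomain M f := ⟨γ, hγ⟩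
  rw [integralEndpoint, dif_pos hp]
  exact IsIntegralSolution.unique hf hK u.integrableOn hp.choose_spec hγ 1 (by simp)

theorem eventually_isIntegralSolution [FiniteDimensional ℝ E] [CompleteSpace V] (hM : IsOpen M)
    (hf : ContDiffOn ℝ ∞ f M) {p : L1Control V × E} (hp : p ∈ integralDomain M f) :
    ∃ φ : L1Control V × E → C(unitInterval, E), ContDiffAt ℝ ∞ φ p ∧
      ∀ᶠ q in 𝓝 p, IsIntegralSolution M f q.1 q.2 (IccExtend zero_le_one (φ q)) := by
  obtain ⟨γ, hγ⟩ := hp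
  exact IsIntegralSolution.exists_contDiffAt hM (.id ℝ (V →L[ℝ] E)) hf hγ

/-- The endpoint system of the controlled differential equation `γ' = f(γ) u` in `M`. -/
noncomputable def integralSystem [FiniteDimensional ℝ E] [CompleteSpace V] (hM : IsOpen M)
    (hf : ContDiffOn ℝ ∞ f M) (hK : ∀ p ∈ M, ∀ q ∈ M, ‖f p - f q‖ ≤ K * ‖p - q‖) :
    EndpointSystem (L1Control V) E where
  dom := integralDomain M f
  endpt := integralEndpoint M f
  isOpen_dom := by
    rw [isOpen_iff_mem_nhds]
    intro p hp
    obtain ⟨φ, -, hφ⟩ := eventually_isIntegralSolution hM hf hp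
    filter_upwards [hφ] with q hq using ⟨_, hq⟩
  contDiffOn p hp := by
    have : CompleteSpace E := FiniteDimensional.complete ℝ E
    obtain ⟨φ, hφs, hφ⟩ := eventually_isIntegralSolution hM hf hp
    have h1 : ContDiffAt ℝ ∞ (fun q ↦ φ q 1) p :=
      ContDiffAt.comp (g := ContinuousMap.evalCLM ℝ (1 : unitInterval)) p
        (ContinuousLinearMap.contDiff _).contDiffAt hφs
    refine (h1.congr_of_eventuallyEq ?_).contDiffWithinAt
    filter_upwards [hφ] with q hq
    rw [← Prod.mk.eta (p := q), integralEndpoint_eq hf.continuousOn hK hq,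
      IccExtend_of_mem _ _ (by simp)]
    rfl
  concat := L1Control.concat
  concat_mem := by
    have : CompleteSpace E := FiniteDimensional.complete ℝ E
    rintro u v x ⟨γ, hγ⟩ ⟨η, hη⟩
    rw [integralEndpoint_eq hf.continuousOn hK hγ] at hη
    exact ⟨_, hγ.concat hf.continuousOn hη⟩
  endpt_concat := by
    have : CompleteSpace E := FiniteDimensional.complete ℝ E
    rintro u v x ⟨γ, hγ⟩ ⟨η, hη⟩
    rw [integralEndpoint_eq hf.continuousOn hK hγ] at hη ⊢
    rw [integralEndpoint_eq hf.continuousOn hK (hγ.concat hf.continuousOn hη),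
      integralEndpoint_eq hf.continuousOn hK hη, concatCurve_one]
  reverse := L1Control.reverse
  reverse_mem := by
    have : CompleteSpace E := FiniteDimensional.complete ℝ E
    rintro u x ⟨γ, hγ⟩
    rw [integralEndpoint_eq hf.continuousOn hK hγ]
    exact ⟨_, hγ.reverse hf.continuousOn⟩
  endpt_reverse := by
    have : CompleteSpace E := FiniteDimensional.complete ℝ E
    rintro u x ⟨γ, hγ⟩
    rw [integralEndpoint_eq hf.continuousOn hK hγ,
      integralEndpoint_eq hf.continuousOn hK (hγ.reverse hf.continuousOn)]
    simpa using hγ.initial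

/-! ### Absolutely continuous curves and the integral equation. -/

theorem absolutelyContinuousOnInterval_primitive {g : ℝ → E} (hg : IntegrableOn g (Icc 0 1)) :
    AbsolutelyContinuousOnInterval (fun t ↦ ∫ s in (0 : ℝ)..t, g s) 0 1 := by
  have hint : IntervalIntegrable g volume 0 1 := IntegrableOn.intervalIntegrable_zero hg (by simp)
  have hac := hint.norm.absolutelyContinuousOnInterval_intervalIntegral (c := 0) (by simp)
  -- Increments of the primitive of `g` are dominated by those of the real primitive of `‖g‖`, whose
  -- absolute continuity is available.
  refine squeeze_zero' (Eventually.of_forall fun _ ↦ Finset.sum_nonneg fun _ _ ↦ dist_nonneg) ?_ hac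
  filter_upwards [mem_inf_of_right (mem_principal_self _)] with I hI
  refine Finset.sum_le_sum fun i hi ↦ ?_
  obtain ⟨ha, hb⟩ := hI.1 i hi
  have hsub : ∀ {t}, t ∈ uIcc (0 : ℝ) 1 → IntervalIntegrable g volume 0 t := fun {t} ht ↦
    hint.mono_set (uIcc_subset_uIcc_left ht)
  rw [dist_eq_norm, dist_eq_norm, intervalIntegral.integral_interval_sub_left (hsub ha) (hsub hb),
    intervalIntegral.integral_interval_sub_left (hsub ha).norm (hsub hb).norm, Real.norm_eq_abs]
  exact intervalIntegral.norm_integral_le_abs_integral_norm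

/-- The difference of the curve and the primitive is absolutely continuous with derivative zero
almost everywhere, hence constant. -/
theorem AbsolutelyContinuousOnInterval.eq_add_integral [CompleteSpace E] {γ g : ℝ → E}
    (hγ : AbsolutelyContinuousOnInterval γ 0 1) (hg : IntegrableOn g (Icc 0 1))
    (h : ∀ᵐ t, t ∈ Icc (0 : ℝ) 1 → HasDerivAt γ (g t) t) :
    ∀ t ∈ Icc (0 : ℝ) 1, γ t = γ 0 + ∫ s in (0 : ℝ)..t, g s := by
  have hint : IntervalIntegrable g volume 0 1 := IntegrableOn.intervalIntegrable_zero hg (by simp)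
  have hac := hγ.fun_sub (absolutelyContinuousOnInterval_primitive hg)
  obtain ⟨C, hC⟩ := hac.const_of_ae_hasDerivAt_zero (by
    filter_upwards [hint.ae_hasDerivAt_integral, h] with t ht1 ht2 ht
    have h2 := ht2 (by rwa [uIcc_of_le zero_le_one] at ht)
    simpa using h2.fun_sub (ht1 ht 0 (by simp)))
  rw [uIcc_of_le zero_le_one] at hC
  have hC0 : C = γ 0 := by
    rw [← hC 0 (by simp), intervalIntegral.integral_same, sub_zero]
  intro t ht
  rw [← hC0, ← hC t ht, sub_add_cancel]

theorem absolutelyContinuousOnInterval_add_integral (x : E) {g : ℝ → E}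
    (hg : IntegrableOn g (Icc 0 1)) :
    AbsolutelyContinuousOnInterval (fun t ↦ x + ∫ s in (0 : ℝ)..t, g s) 0 1 := by
  have hconst : AbsolutelyContinuousOnInterval (fun _ : ℝ ↦ x) 0 1 :=
    contDiffOn_const.absolutelyContinuousOnInterval
  exact hconst.fun_add (absolutelyContinuousOnInterval_primitive hg)

theorem ae_hasDerivAt_add_integral [CompleteSpace E] (x : E) {g : ℝ → E}
    (hg : IntegrableOn g (Icc 0 1)) : ∀ᵐ t, t ∈ Icc (0 : ℝ) 1 →
      HasDerivAt (fun t ↦ x + ∫ s in (0 : ℝ)..t, g s) (g t) t := by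
  have hint : IntervalIntegrable g volume 0 1 := IntegrableOn.intervalIntegrable_zero hg (by simp)
  filter_upwards [hint.ae_hasDerivAt_integral] with t ht hmem
  exact (ht (by rwa [uIcc_of_le zero_le_one]) 0 (by simp)).const_add _

theorem IsIntegralSolution.integrableOn (hf : ContinuousOn f M) {u : L1Control V} {x : E}
    {γ : ℝ → E} (h : IsIntegralSolution M f u x γ) :
    IntegrableOn (fun s ↦ f (γ s) (u s)) (Icc 0 1) :=
  IntegrableOn.clm_apply_of_continuousOn (hf.comp h.continuousOn h.mem) u.integrableOn

end System

variable {m k : ℕ} {M : TopologicalSpace.Opens (EuclideanSpace ℝ (Fin m))}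
  {X : Fin k → EuclideanSpace ℝ (Fin m) → EuclideanSpace ℝ (Fin m)}

/-- The operator `c ↦ ∑ᵢ cᵢ Xᵢ(p)`. -/
noncomputable def controlField (X : Fin k → EuclideanSpace ℝ (Fin m) → EuclideanSpace ℝ (Fin m))
    (p : EuclideanSpace ℝ (Fin m)) : EuclideanSpace ℝ (Fin k) →L[ℝ] EuclideanSpace ℝ (Fin m) :=
  ∑ i, (EuclideanSpace.proj i).smulRight (X i p)

theorem controlField_apply (p : EuclideanSpace ℝ (Fin m)) (c : EuclideanSpace ℝ (Fin k)) :
    controlField X p c = ∑ i, c i • X i p := by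
  simp [controlField]

theorem contDiffOn_controlField {O : Set (EuclideanSpace ℝ (Fin m))}
    (hX : ∀ i, ContDiffOn ℝ ∞ (X i) O) : ContDiffOn ℝ ∞ (controlField X) O := by
  unfold controlField
  refine ContDiffOn.sum fun i _ ↦ ?_
  exact (ContinuousLinearMap.smulRightL ℝ (EuclideanSpace ℝ (Fin k)) (EuclideanSpace ℝ (Fin m))
    (EuclideanSpace.proj i)).contDiff.comp_contDiffOn (hX i)

theorem exists_controlField_lipschitz {O : Set (EuclideanSpace ℝ (Fin m))}
    (hL : ∃ L : ℝ, ∀ i, ∀ x ∈ O, ∀ y ∈ O, ‖X i x - X i y‖ ≤ L * ‖x - y‖) :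
    ∃ K : ℝ, ∀ p ∈ O, ∀ q ∈ O, ‖controlField X p - controlField X q‖ ≤ K * ‖p - q‖ := by
  obtain ⟨L, hL⟩ := hL
  refine ⟨∑ i : Fin k, ‖(EuclideanSpace.proj i : EuclideanSpace ℝ (Fin k) →L[ℝ] ℝ)‖ * L,
    fun p hp q hq ↦ ?_⟩
  rw [controlField, controlField, ← Finset.sum_sub_distrib, Finset.sum_mul]
  refine norm_sum_le_of_le _ fun i _ ↦ ?_
  have : (EuclideanSpace.proj i : EuclideanSpace ℝ (Fin k) →L[ℝ] ℝ).smulRight (X i p) -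
      (EuclideanSpace.proj i).smulRight (X i q) =
      (EuclideanSpace.proj i).smulRight (X i p - X i q) := by
    ext c
    simp [smul_sub]
  rw [this, ContinuousLinearMap.norm_smulRight_apply, mul_assoc]
  gcongr
  exact hL i p hp q hq

theorem IsControlledCurve.isIntegralSolution
    (hX : ∀ i, ContDiffOn ℝ ∞ (X i) M) {u : ControlSpace k} {x : M}
    {γ : ℝ → EuclideanSpace ℝ (Fin m)} (h : IsControlledCurve M X u x γ) :
    IsIntegralSolution M (controlField X) u x γ := by
  have hc : ContinuousOn γ (Icc 0 1) := by
    have := h.absolutelyContinuous.continuousOn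
    rwa [uIcc_of_le zero_le_one] at this
  have hfc := (contDiffOn_controlField hX).continuousOn.comp hc h.mem
  have hode := (ae_restrict_iff' measurableSet_Icc).1 h.ode
  simp_rw [← controlField_apply] at hode
  refine ⟨hc, h.mem, ?_⟩
  rw [← h.initial]
  exact AbsolutelyContinuousOnInterval.eq_add_integral h.absolutelyContinuous
    (IntegrableOn.clm_apply_of_continuousOn hfc (L1Control.integrableOn u)) hode

theorem IsIntegralSolution.exists_isControlledCurve
    (hX : ∀ i, ContDiffOn ℝ ∞ (X i) M) {u : ControlSpace k} {x : M}
    {γ : ℝ → EuclideanSpace ℝ (Fin m)} (h : IsIntegralSolution M (controlField X) u x γ) :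
    ∃ η, IsControlledCurve M X u x η := by
  have hg := h.integrableOn (contDiffOn_controlField hX).continuousOn
  have hη : ∀ t ∈ Icc (0 : ℝ) 1, (x : EuclideanSpace ℝ (Fin m)) +
      ∫ s in (0 : ℝ)..t, controlField X (γ s) (u s) = γ t := fun t ht ↦ (h.eq t ht).symm
  -- The controlled curve is the primitive on the right-hand side of the integral equation, which
  -- agrees with `γ` on `[0,1]`.
  refine ⟨_, absolutelyContinuousOnInterval_add_integral (x : EuclideanSpace ℝ (Fin m)) hg,
    fun t ht ↦ ?_, by rw [intervalIntegral.integral_same, add_zero], ?_⟩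
  · rw [hη t ht]
    exact h.mem t ht
  · rw [ae_restrict_iff' measurableSet_Icc]
    filter_upwards [ae_hasDerivAt_add_integral (x : EuclideanSpace ℝ (Fin m)) hg] with t ht hmem
    rw [← controlField_apply, hη t hmem]
    exact ht hmem

end ControlledEquation

/-! ### Initial submanifolds from slice parametrizations -/

section InitialSubmanifold

open Set Topology

variable {m n : ℕ} {h : n ≤ m} {M : TopologicalSpace.Opens (EuclideanSpace ℝ (Fin m))} {N : Set M}

namespace IsSliceParametrization

variable {S : Set (EuclideanSpace ℝ (Fin m))} {y : M}
  {e : OpenPartialHomeomorph (EuclideanSpace ℝ (Fin m)) (EuclideanSpace ℝ (Fin m))}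

/-- The chart of the open set `M` inverse to a slice parametrization. -/
noncomputable def chart (_ : IsSliceParametrization h M S y e) :
    OpenPartialHomeomorph M (EuclideanSpace ℝ (Fin m)) :=
  e.symm.subtypeRestr ⟨y⟩

theorem chart_apply (he : IsSliceParametrization h M S y e) (p : M) : he.chart p = e.symm p := rfl

theorem mem_chart_source (he : IsSliceParametrization h M S y e) {p : M} :
    p ∈ he.chart.source ↔ (p : EuclideanSpace ℝ (Fin m)) ∈ e.target := by
  rw [chart, OpenPartialHomeomorph.subtypeRestr_source]
  rfl

theorem chart_target (he : IsSliceParametrization h M S y e) : he.chart.target = e.source := by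
  refine (OpenPartialHomeomorph.subtypeRestr_target_subset _ _).antisymm fun w hw ↦ ?_
  have hM : e w ∈ M := he.target_subset (e.map_source hw)
  have := e.symm.map_subtype_source ⟨y⟩ (x := ⟨e w, hM⟩) (e.map_source hw)
  rwa [e.left_inv hw] at this

theorem coe_chart_symm (he : IsSliceParametrization h M S y e)
    {w : EuclideanSpace ℝ (Fin m)} (hw : w ∈ e.source) :
    (he.chart.symm w : EuclideanSpace ℝ (Fin m)) = e w :=
  (e.symm.subtypeRestr_symm_eqOn ⟨y⟩ (he.chart_target.symm ▸ hw)).symm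

theorem chart_mem_maximalAtlas (he : IsSliceParametrization h M S y e) :
    he.chart ∈ IsManifold.maximalAtlas (𝓡 m) ∞ M := by
  apply OpenPartialHomeomorph.mem_maximalAtlas_of_contMDiffOn
  · exact he.contDiffOn_symm.contMDiffOn.comp contMDiff_subtype_val.contMDiffOn
      fun p hp ↦ he.mem_chart_source.1 hp
  · intro w hw
    rw [← ContMDiffWithinAt.subtypeVal_comp_iff]
    rw [he.chart_target] at hw ⊢
    exact (he.contDiffOn.contMDiffOn w hw).congr (fun w hw ↦ he.coe_chart_symm hw)
      (he.coe_chart_symm hw)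

/-- A path in `N` inside the chart domain keeps normal coordinate 0 by connectedness. Conversely, a
point of `ℝⁿ × {0}` in the ball is joined to 0 by a straight segment, which the slice property
carries into `N`. -/
theorem isInitialSubmanifoldChart (he : IsSliceParametrization h M (Subtype.val '' N) y e) :
    IsInitialSubmanifoldChart (m := m) N y he.chart := by
  have hys : y ∈ he.chart.source := he.mem_chart_source.2 he.mem_target
  have hy0 : he.chart y = 0 := he.symm_apply_base
  refine ⟨he.chart_mem_maximalAtlas, hys, hy0, n, h, Subset.antisymm ?_ ?_⟩
  · rintro _ ⟨p, ⟨c, hc, hc0, rfl, hcN⟩, rfl⟩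
    have h1 : (1 : ℝ) ∈ Icc (0 : ℝ) 1 := by simp
    refine ⟨he.chart.map_source (hcN 1 h1).1, (coordNormal_eq_zero_iff h _).1 ?_⟩
    rw [chart_apply, he.coordNormal_eq_of_isPreconnected (f := fun t ↦ (c t : EuclideanSpace ℝ _))
      isPreconnected_Icc (continuous_subtype_val.comp_continuousOn hc.continuousOn)
      (fun t ht ↦ ⟨⟨c t, (hcN t ht).2, rfl⟩, he.mem_chart_source.1 (hcN t ht).1⟩) h1
      (z' := 0) (by simp), hc0, he.symm_apply_base, _root_.map_zero]
  · rintro w ⟨hw, hwn⟩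
    rw [he.chart_target] at hw
    rw [← coordNormal_eq_zero_iff h] at hwn
    have hseg : ∀ t ∈ Icc (0 : ℝ) 1, t • w ∈ e.source := by
      obtain ⟨r, -, hr⟩ := he.exists_source_eq_ball
      intro t ht
      rw [hr, mem_ball_zero_iff] at hw ⊢
      rw [norm_smul, Real.norm_of_nonneg ht.1]
      exact (mul_le_of_le_one_left (norm_nonneg w) ht.2).trans_lt hw
    refine ⟨he.chart.symm w, ⟨fun t ↦ he.chart.symm (t • w), ?_, ?_, ?_, fun t ht ↦ ⟨?_, ?_⟩⟩, ?_⟩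
    · have hsmul : ContMDiff 𝓘(ℝ, ℝ) (𝓡 m) ∞ fun t : ℝ ↦ t • w :=
        (contDiff_id.smul contDiff_const).contMDiff
      exact (contMDiffOn_symm_of_mem_maximalAtlas he.chart_mem_maximalAtlas).comp hsmul.contMDiffOn
        fun t ht ↦ he.chart_target.symm ▸ hseg t ht
    · simp only [zero_smul]
      rw [← hy0, he.chart.left_inv hys]
    · simp only [one_smul]
    · exact he.chart.map_target (he.chart_target.symm ▸ hseg t ht)
    · obtain ⟨p, hp, hpe⟩ := he.slice_mem _ (hseg t ht) (by rw [map_smul, hwn, smul_zero])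
      have hpc : p = he.chart.symm (t • w) :=
        Subtype.ext (hpe.trans (he.coe_chart_symm (hseg t ht)).symm)
      change he.chart.symm (t • w) ∈ N
      rwa [← hpc]
    · exact he.chart.right_inv (he.chart_target.symm ▸ hw)

end IsSliceParametrization

theorem isInitialSubmanifold_of_slices
    (hN : ∀ y ∈ N, ∃ e, IsSliceParametrization h M (Subtype.val '' N) y e) :
    IsInitialSubmanifold (m := m) N := fun y hy ↦
  let ⟨_, he⟩ := hN y hy
  ⟨_, he.isInitialSubmanifoldChart⟩

theorem inclusionIsInitial_of_slices
    (hN : ∀ y ∈ N, ∃ e, IsSliceParametrization h M (Subtype.val '' N) y e) {Y : Type*}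
    [TopologicalSpace Y] [SecondCountableTopology Y] [LocallyConnectedSpace Y]
    {g : Y → Carrier N} (hg : Function.Surjective g) (hgc : Continuous fun q ↦ Carrier.incl N (g q)) :
    InclusionIsInitial.{u} (m := m) N := by
  let ι : Carrier N → EuclideanSpace ℝ (Fin m) := fun p ↦ (Carrier.incl N p).1
  have hι : Function.Injective ι := Subtype.val_injective.comp Subtype.val_injective
  have hrange : range ι = Subtype.val '' N := by
    ext p
    exact ⟨fun ⟨q, hq⟩ ↦ ⟨q.1, q.2, hq⟩, fun ⟨q, hq, hqp⟩ ↦ ⟨⟨q, hq⟩, hqp⟩⟩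
  choose e he using fun y : Carrier N ↦ hN y.1 y.2
  rw [← hrange] at he
  change ∀ y, IsSliceParametrization h M (range ι) (ι y) (e y) at he
  let t : TopologicalSpace (Carrier N) := leafTopology h ι e
  have ht : t = leafTopology h ι e := rfl
  let c : ChartedSpace (EuclideanSpace ℝ (Fin n)) (Carrier N) := leafChartedSpace ht hι he
  have hincl : ContMDiff (𝓡 n) (𝓡 m) ∞ (Carrier.incl N) :=
    (ContMDiff.subtypeVal_comp_iff _ _).1 (contMDiff_leaf_inclusion ht hι he)
  refine ⟨n, t, c, isManifold_leaf ht hι he, t2Space_leaf ht hι he,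
    paracompactSpace_leaf ht hι he hg (continuous_subtype_val.comp hgc),
    ⟨Subtype.val_injective, hincl, fun p ↦ ?_⟩, fun d Z _ _ _ _ _ f ↦ ⟨fun hf ↦ hincl.comp hf,
      fun hf ↦ contMDiff_leaf ht hι he (contMDiff_subtype_val.comp hf)⟩⟩
  exact mfderiv_injective_of_factor ht hι he contMDiff_subtype_val (fun _ ↦ rfl) hincl p

end InitialSubmanifold

/-! ### The image of the endpoint map as an orbit. -/

section Main

open Set

variable {m k : ℕ} {M : TopologicalSpace.Opens (EuclideanSpace ℝ (Fin m))}
  {X : Fin k → EuclideanSpace ℝ (Fin m) → EuclideanSpace ℝ (Fin m)} {K : ℝ}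

theorem mem_controlDomain_iff (hX : ∀ i, ContDiffOn ℝ ∞ (X i) M) {u : ControlSpace k} {x : M} :
    (u, x) ∈ controlDomain M X ↔
      (u, (x : EuclideanSpace ℝ (Fin m))) ∈ integralDomain M (controlField X) :=
  ⟨fun ⟨_, hγ⟩ ↦ ⟨_, hγ.isIntegralSolution hX⟩, fun ⟨_, hγ⟩ ↦ hγ.exists_isControlledCurve hX⟩

theorem coe_endpointMap (hX : ∀ i, ContDiffOn ℝ ∞ (X i) M)
    (hK : ∀ p ∈ M, ∀ q ∈ M, ‖controlField X p - controlField X q‖ ≤ K * ‖p - q‖) (x : M)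
    (u : {u : ControlSpace k // (u, x) ∈ controlDomain M X}) :
    (endpointMap M X x u : EuclideanSpace ℝ (Fin m)) =
      integralEndpoint M (controlField X) (u.1, (x : EuclideanSpace ℝ (Fin m))) :=
  (integralEndpoint_eq (contDiffOn_controlField hX).continuousOn hK
    (u.2.choose_spec.isIntegralSolution hX)).symm

theorem image_range_endpointMap (hX : ∀ i, ContDiffOn ℝ ∞ (X i) M)
    (hK : ∀ p ∈ M, ∀ q ∈ M, ‖controlField X p - controlField X q‖ ≤ K * ‖p - q‖) (x : M) :
    Subtype.val '' range (endpointMap M X x) =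
      (integralSystem M.isOpen (contDiffOn_controlField hX) hK).orbit x := by
  ext p
  constructor
  · rintro ⟨_, ⟨u, rfl⟩, rfl⟩
    exact ⟨u.1, (mem_controlDomain_iff hX).1 u.2, (coe_endpointMap hX hK x u).symm⟩
  · rintro ⟨u, hu, rfl⟩
    exact ⟨_, ⟨⟨u, (mem_controlDomain_iff hX).2 hu⟩, rfl⟩, coe_endpointMap hX hK x _⟩

theorem locallyConnectedSpace_controlDomain (hX : ∀ i, ContDiffOn ℝ ∞ (X i) M)
    (hK : ∀ p ∈ M, ∀ q ∈ M, ‖controlField X p - controlField X q‖ ≤ K * ‖p - q‖) (x : M) :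
    LocallyConnectedSpace {u : ControlSpace k // (u, x) ∈ controlDomain M X} := by
  have hO : IsOpen {u : ControlSpace k | (u, x) ∈ controlDomain M X} := by
    simp_rw [mem_controlDomain_iff hX]
    exact (integralSystem M.isOpen (contDiffOn_controlField hX) hK).isOpen_dom.preimage
      (Continuous.prodMk_left _)
  exact hO.locallyConnectedSpace

theorem continuous_endpointMap (hX : ∀ i, ContDiffOn ℝ ∞ (X i) M)
    (hK : ∀ p ∈ M, ∀ q ∈ M, ‖controlField X p - controlField X q‖ ≤ K * ‖p - q‖) (x : M) :
    Continuous (endpointMap M X x) := by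
  rw [continuous_induced_rng]
  have h := (integralSystem M.isOpen (contDiffOn_controlField hX) hK).contDiffOn.continuousOn
  refine (h.comp_continuous (f := fun u : {u : ControlSpace k // (u, x) ∈ controlDomain M X} ↦
    ((u : ControlSpace k), (x : EuclideanSpace ℝ (Fin m)))) (by fun_prop)
    fun u ↦ (mem_controlDomain_iff hX).1 u.2).congr fun u ↦ (coe_endpointMap hX hK x u).symm

instance secondCountableTopology_controlSpace : SecondCountableTopology (ControlSpace k) := by
  have : Fact ((1 : ENNReal) ≠ ⊤) := ⟨ENNReal.one_ne_top⟩
  infer_instance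

end Main

theorem mainTheorem9 {m k : ℕ} (M : TopologicalSpace.Opens (EuclideanSpace ℝ (Fin m)))
    (hM : IsConnected (M : Set (EuclideanSpace ℝ (Fin m))))
    (X : Fin k → EuclideanSpace ℝ (Fin m) → EuclideanSpace ℝ (Fin m))
    (hX : ∀ i, ContDiffOn ℝ ∞ (X i) M)
    (hbounded : ∃ K : ℝ, ∀ i, ∀ x ∈ M, ‖X i x‖ ≤ K)
    (hLipschitz : ∃ L : ℝ, ∀ i, ∀ x ∈ M, ∀ y ∈ M, ‖X i x - X i y‖ ≤ L * ‖x - y‖)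
    (x : M) :
    IsInitialSubmanifold (m := m) (Set.range (endpointMap M X x)) ∧
      InclusionIsInitial.{u} (m := m) (Set.range (endpointMap M X x)) := by
  obtain ⟨K, hK⟩ := exists_controlField_lipschitz (O := (M : Set (EuclideanSpace ℝ (Fin m)))) hLipschitz
  let S := integralSystem M.isOpen (contDiffOn_controlField hX) hK
  have hrank : S.orbitRank x ≤ m := by
    simpa only [finrank_euclideanSpace_fin] using S.orbitRank_le (x : EuclideanSpace ℝ (Fin m))
  have hslice : ∀ y ∈ Set.range (endpointMap M X x), ∃ e, IsSliceParametrization hrank M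
      (Subtype.val '' Set.range (endpointMap M X x)) (y : EuclideanSpace ℝ (Fin m)) e := by
    intro y hy
    have hy' := Set.mem_image_of_mem Subtype.val hy
    rw [image_range_endpointMap hX hK] at hy' ⊢
    exact EndpointSystem.exists_isSliceParametrization hrank M.isOpen hy' y.2
  have := locallyConnectedSpace_controlDomain hX hK x
  -- For paracompactness, the endpoint map itself serves as the continuous surjection from a second
  -- countable, locally connected space.
  refine ⟨isInitialSubmanifold_of_slices hslice, inclusionIsInitial_of_slices hslice
    (g := fun u ↦ ⟨endpointMap M X x u, u, rfl⟩) ?_ (continuous_endpointMap hX hK x)⟩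
  rintro ⟨_, u, rfl⟩
  exact ⟨u, rfl⟩
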